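/- Let $(R_n)_{n\in\mathbb N}$ be a family of commutative rings with an injective encoding of polynomial length in which $0\in R_n$ can be written down in polynomial time from $1^n$. Let $\mathcal E=(\mathsf{KeyGen},\mathsf{Enc},\mathsf{Dec},\mathsf{Add},\mathsf{Mul})$ be a public-key cryptosystem with plaintext ring $R_n$ for security parameter $n$, all of whose algorithms are polynomial-time functions of their inputs and of a uniformly random string of polynomial-time computable length, and such that fresh ciphertexts are always decrypted correctly. Assume that (a) $\mathcal E$ is semantically secure: for all $(m_n),(m'_n)$ with $m_n,m'_n\in R_n$ the ensembles $(pk,\mathsf{Enc}_{pk}(m_n))$ and $(pk,\mathsf{Enc}_{pk}(m'_n))$ are computationally indistinguishable (by deterministic polynomial-time algorithms with polynomial-size advice, as everywhere below); (b) the homomorphic operations of $\mathcal E$ are function-private: there is a negligible $\varepsilon$ such that for every $n$, every generated key, all $m,m'\in R_n$ and all ciphertexts $c,c'$ in the range of $\mathsf{Enc}_{pk}(m),\mathsf{Enc}_{pk}(m')$, the distributions of $\mathsf{Add}_{pk}(c,c')$ and $\mathsf{Mul}_{pk}(c,c')$ are within statistical distance $\varepsilon(n)$ of $\mathsf{Enc}_{pk}(m+m')$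 and $\mathsf{Enc}_{pk}(mm')$, respectively. The PROUD protocol runs between a client with input $x\in R_n^k$ and a server whose input is a neural network $N$ with $k$ inputs and $m$ outputs over $R_n$: affine layers $h\mapsto Wh+b$, each except the last followed by coordinatewise application of a polynomial $\sum_{j<D}a_jz^j$ (the polynomial approximation of the activation function). Common inputs are $1^n,1^k,1^m$. The client generates $(pk,sk)$ and sends $pk$ and the coordinatewise encryption of $x$. The server evaluates $N$ on ciphertexts, with weights, biases and coefficients encrypted under $pk$: each affine layer by the subprotocol MatF (homomorphic matrix computation, by $\mathsf{Mul}$ and $\mathsf{Add}$) and each polynomial by the subprotocol PolyF (Horner's rule, by $\mathsf{Mul}$ and $\mathsf{Add}$). It sends the ciphertexts of the last layer to the client, who decrypts them. Then PROUD is secure against semi-honest adversaries, that is, it privately computes $(x,N)\mapsto(N(x),\text{nothing})$. For all inputs of length polynomial in $n$: 1. the client's output is $N(x)$ except with negligible probability; 2. there is a probabilistic polynomial-time simulator, not depending on the inputs, which from $1^n,1^k,1^m$, $x$ and $N(x)$ produces a distribution that is computationally indistinguishable from the client's view (input, coin tosses, received ciphertexts); 3. there is a probabilistic polynomial-time simulator,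 not depending on the inputs, which from $1^n,1^k,1^m$ and $N$ alone produces a distribution that is computationally indistinguishable from the server's view (input, coin tosses, received public key and ciphertexts). -/

import Mathlib

open Filter

noncomputable section

namespace Proud

/-! ### Data and their encodings -/

/-- Binary trees: the values that programs manipulate. -/
inductive Data : Type
  | nil : Data
  | cons (a b : Data) : Data

namespace Data

/-- Number of nodes. -/
def size : Data → ℕ
  | nil => 1
  | cons a b => 1 + a.size + b.size

def hd : Data → Data
  | nil => nil
  | cons a _ => a

def tl : Data → Data
  | nil => nil
  | cons _ b => b

/-- Lists and tuples of data. -/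
def list : List Data → Data
  | [] => nil
  | a :: l => cons a (list l)

/-- The number `n` in unary. -/
def unary (n : ℕ) : Data := list (List.replicate n nil)

def bit : Bool → Data
  | false => nil
  | true => cons nil nil

def bits {l : ℕ} (r : Fin l → Bool) : Data := list (List.ofFn fun i => bit (r i))

end Data

/-! ### Probabilistic programs with a step count -/

inductive Expr : Type
  | nil : Expr
  | var (y : ℕ) : Expr
  | cons (y z : ℕ) : Expr
  | hd (y : ℕ) : Expr
  | tl (y : ℕ) : Expr

/-- Contents of the variables, which are numbered `0, 1, 2, …`. -/
abbrev State : Type := ℕ → Data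

def Expr.eval (σ : State) : Expr → Data
  | nil => Data.nil
  | var y => σ y
  | cons y z => Data.cons (σ y) (σ z)
  | hd y => (σ y).hd
  | tl y => (σ y).tl

/-- While-programs over binary trees, with a coin-tossing instruction. -/
inductive Prog : Type
  | skip : Prog
  | assign (x : ℕ) (e : Expr) : Prog
  | flip (x : ℕ) : Prog
  | seq (p q : Prog) : Prog
  | ite (x : ℕ) (p q : Prog) : Prog
  | loop (x : ℕ) (p : Prog) : Prog

/-- `Runs p σ t μ`: started in the state `σ`, the program `p` halts within `t` steps on every outcome
of its coin tosses, and its final state has the distribution `μ`. Writing a value costs as many steps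
as the value has nodes, so that data cannot grow faster than the time that is spent. A test looks
whether a variable is different from `nil`. -/
inductive Runs : Prog → State → ℕ → PMF State → Prop
  | skip (σ : State) : Runs Prog.skip σ 1 (PMF.pure σ)
  | assign (x : ℕ) (e : Expr) (σ : State) :
      Runs (Prog.assign x e) σ (e.eval σ).size (PMF.pure (Function.update σ x (e.eval σ)))
  | flip (x : ℕ) (σ : State) :
      Runs (Prog.flip x) σ 3
        ((PMF.uniformOfFintype Bool).map fun b => Function.update σ x (Data.bit b))
  | seq {p q : Prog} {σ : State} {s t : ℕ} {μ : PMF State} {ν : State → PMF State} :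
      Runs p σ s μ → (∀ τ ∈ μ.support, Runs q τ t (ν τ)) →
      Runs (Prog.seq p q) σ (s + t) (μ.bind ν)
  | ite_true {x : ℕ} {p q : Prog} {σ : State} {t : ℕ} {μ : PMF State} :
      σ x ≠ Data.nil → Runs p σ t μ → Runs (Prog.ite x p q) σ (t + 1) μ
  | ite_false {x : ℕ} {p q : Prog} {σ : State} {t : ℕ} {μ : PMF State} :
      σ x = Data.nil → Runs q σ t μ → Runs (Prog.ite x p q) σ (t + 1) μ
  | loop_done {x : ℕ} {p : Prog} {σ : State} :
      σ x = Data.nil → Runs (Prog.loop x p) σ 1 (PMF.pure σ)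
  | loop_step {x : ℕ} {p : Prog} {σ : State} {t : ℕ} {μ : PMF State} :
      σ x ≠ Data.nil → Runs (Prog.seq p (Prog.loop x p)) σ t μ →
      Runs (Prog.loop x p) σ (t + 1) μ
  | mono {p : Prog} {σ : State} {s t : ℕ} {μ : PMF State} :
      Runs p σ s μ → s ≤ t → Runs p σ t μ

/-- The input is in variable `0`, all other variables are `nil`. -/
def initState (d : Data) : State := fun i => if i = 0 then d else Data.nil

/-- `A` is a probabilistic polynomial-time algorithm: one program outputs (in variable `0`) a sample
of `A d` on every input `d`, within time polynomial in the size of `d`. -/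
def PPT (A : Data → PMF Data) : Prop :=
  ∃ (p : Prog) (k : ℕ), ∀ d : Data, ∃ (t : ℕ) (μ : PMF State),
    Runs p (initState d) t μ ∧ μ.map (fun σ => σ 0) = A d ∧ t ≤ d.size ^ k + k

/-- `f` is computable in polynomial time. -/
def PolyTime (f : Data → Data) : Prop := PPT fun d => PMF.pure (f d)

/-! ### Asymptotic notions -/

def Negligible (ε : ℕ → ℝ) : Prop :=
  Asymptotics.SuperpolynomialDecay atTop (fun n : ℕ => (n : ℝ)) ε

def PolySize (a : ℕ → Data) : Prop := ∃ k : ℕ, ∀ n : ℕ, (a n).size ≤ n ^ k + k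

/-- Probability that the algorithm `D`, given the security parameter, the advice `a` and a sample of
`X`, outputs the bit `1`. -/
def acceptProb (D : Data → Data) (n : ℕ) (a : Data) (X : PMF Data) : ℝ :=
  ((X.map fun v => D (Data.list [Data.unary n, a, v])) (Data.bit true)).toReal

/-- Computational indistinguishability against non-uniform polynomial-time distinguishers. -/
def CompIndist (X Y : ℕ → PMF Data) : Prop :=
  ∀ D : Data → Data, PolyTime D → ∀ a : ℕ → Data, PolySize a →
    Negligible fun n => |acceptProb D n (a n) (X n) - acceptProb D n (a n) (Y n)|

/-- Statistical distance at most `ε`. -/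
def StatClose (ε : ℝ) (X Y : PMF Data) : Prop :=
  ∀ s : Set Data, |(X.toOuterMeasure s).toReal - (Y.toOuterMeasure s).toReal| ≤ ε

/-! ### Homomorphic public-key encryption -/

/-- A public-key encryption scheme with public operations for adding and multiplying ciphertexts.
For the security parameter `n` the plaintexts form the ring `R n`. All algorithms are deterministic
polynomial-time functions of their inputs and of an explicit string of `coins n` random bits. -/
structure HEScheme (R : ℕ → Type) [∀ n, CommRing (R n)] where
  /-- Binary representation of the plaintexts. -/
  code : ∀ n, R n → Data
  code_injective : ∀ n, Function.Injective (code n)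
  code_size : ∃ k : ℕ, ∀ (n : ℕ) (m : R n), (code n m).size ≤ n ^ k + k
  zero_code : ∃ f : Data → Data, PolyTime f ∧ ∀ n, f (Data.unary n) = code n 0
  /-- Number of random bits of one call of an algorithm. -/
  coins : ℕ → ℕ
  coins_code : ∃ f : Data → Data, PolyTime f ∧ ∀ n, f (Data.unary n) = Data.unary (coins n)
  /-- Input `(1ⁿ, r)`, output the pair of the public and the secret key. -/
  keyGen : Data → Data
  keyGen_polyTime : PolyTime keyGen
  /-- Input `(1ⁿ, pk, m, r)`. -/
  enc : Data → Data
  enc_polyTime : PolyTime enc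
  /-- Input `(1ⁿ, sk, c)`. -/
  dec : Data → Data
  dec_polyTime : PolyTime dec
  /-- Input `(1ⁿ, pk, c, c', r)`. -/
  add : Data → Data
  add_polyTime : PolyTime add
  /-- Input `(1ⁿ, pk, c, c', r)`. -/
  mul : Data → Data
  mul_polyTime : PolyTime mul
  /-- Fresh ciphertexts are decrypted correctly. -/
  dec_enc : ∀ (n : ℕ) (rK r : Fin (coins n) → Bool) (m : R n),
    dec (Data.list [Data.unary n, (keyGen (Data.list [Data.unary n, Data.bits rK])).tl,
      enc (Data.list [Data.unary n, (keyGen (Data.list [Data.unary n, Data.bits rK])).hd,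
        code n m, Data.bits r])]) = code n m

namespace HEScheme

variable {R : ℕ → Type} [∀ n, CommRing (R n)] (S : HEScheme R)

/-- Random strings of one call of an algorithm. -/
abbrev Coin (n : ℕ) : Type := Fin (S.coins n) → Bool

def toss (n : ℕ) : PMF (S.Coin n) := PMF.uniformOfFintype (S.Coin n)

def pk (n : ℕ) (r : S.Coin n) : Data :=
  (S.keyGen (Data.list [Data.unary n, Data.bits r])).hd

def sk (n : ℕ) (r : S.Coin n) : Data :=
  (S.keyGen (Data.list [Data.unary n, Data.bits r])).tl

def encrypt (n : ℕ) (pk : Data) (m : R n) (r : S.Coin n) : Data :=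
  S.enc (Data.list [Data.unary n, pk, S.code n m, Data.bits r])

def decrypt (n : ℕ) (sk c : Data) : Data :=
  S.dec (Data.list [Data.unary n, sk, c])

def addC (n : ℕ) (pk c c' : Data) (r : S.Coin n) : Data :=
  S.add (Data.list [Data.unary n, pk, c, c', Data.bits r])

def mulC (n : ℕ) (pk c c' : Data) (r : S.Coin n) : Data :=
  S.mul (Data.list [Data.unary n, pk, c, c', Data.bits r])

/-- A fresh public key together with an encryption of `m` under it. -/
def challenge (n : ℕ) (m : R n) : PMF Data :=
  (S.toss n).bind fun rK => (S.toss n).map fun r =>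
    Data.list [S.pk n rK, S.encrypt n (S.pk n rK) m r]

/-- Semantic security, in the form of indistinguishability of encryptions given the public key. -/
def SemanticallySecure : Prop :=
  ∀ m₀ m₁ : ∀ n, R n, CompIndist (fun n => S.challenge n (m₀ n)) (fun n => S.challenge n (m₁ n))

/-- Each single homomorphic operation, applied to any two fresh ciphertexts, outputs a ciphertext that
is statistically indistinguishable from a fresh encryption of the sum or the product. -/
def StronglyHomomorphic : Prop :=
  ∃ ε : ℕ → ℝ, Negligible ε ∧
    ∀ (n : ℕ) (rK : S.Coin n) (m₁ m₂ : R n) (r₁ r₂ : S.Coin n),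
      StatClose (ε n)
        ((S.toss n).map (S.addC n (S.pk n rK)
          (S.encrypt n (S.pk n rK) m₁ r₁) (S.encrypt n (S.pk n rK) m₂ r₂)))
        ((S.toss n).map (S.encrypt n (S.pk n rK) (m₁ + m₂))) ∧
      StatClose (ε n)
        ((S.toss n).map (S.mulC n (S.pk n rK)
          (S.encrypt n (S.pk n rK) m₁ r₁) (S.encrypt n (S.pk n rK) m₂ r₂)))
        ((S.toss n).map (S.encrypt n (S.pk n rK) (m₁ * m₂)))

end HEScheme

/-! ### Networks with polynomial activations -/

/-- Networks with `k` inputs and `m` outputs: affine layers, each but the last one followed by the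
coordinatewise application of the polynomial `∑ aᵢ zⁱ`. -/
inductive Net (A : Type) : ℕ → ℕ → Type
  | last {k m : ℕ} (W : Matrix (Fin m) (Fin k) A) (b : Fin m → A) : Net A k m
  | hidden {k l m D : ℕ} (W : Matrix (Fin l) (Fin k) A) (b : Fin l → A) (a : Fin D → A)
      (rest : Net A l m) : Net A k m

/-- The function that a network computes. -/
def Net.eval {A : Type} [CommRing A] : {k m : ℕ} → Net A k m → (Fin k → A) → (Fin m → A)
  | _, _, .last W b, x => W.mulVec x + b
  | _, _, .hidden W b a rest, x =>
      rest.eval fun i => ∑ j, a j * (W.mulVec x + b) i ^ (j : ℕ)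

/-- The list of the rows, each as the bias followed by the weights. -/
def affineCode {A : Type} (code : A → Data) {k m : ℕ} (W : Matrix (Fin m) (Fin k) A)
    (b : Fin m → A) : Data :=
  Data.list (List.ofFn fun i =>
    Data.cons (code (b i)) (Data.list (List.ofFn fun j => code (W i j))))

/-- The list of the layers. -/
def Net.code {A : Type} (code : A → Data) : {k m : ℕ} → Net A k m → Data
  | _, _, .last W b => Data.list [affineCode code W b]
  | _, _, .hidden W b a rest =>
      Data.cons (Data.cons (affineCode code W b) (Data.list (List.ofFn fun j => code (a j))))
        (rest.code code)

/-! ### The subprotocols MatF and PolyF, run by the server -/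

/-- Randomized computations that record the outcomes of their coin tosses. -/
abbrev Logged : Type → Type := StateT (List Data) PMF

section Server

variable {R : ℕ → Type} [∀ n, CommRing (R n)] (S : HEScheme R)

def loggedToss (n : ℕ) : Logged (S.Coin n) := fun log =>
  (S.toss n).map fun r => (r, log ++ [Data.bits r])

def encL (n : ℕ) (pk : Data) (m : R n) : Logged Data := do
  let r ← loggedToss S n
  return S.encrypt n pk m r

def addL (n : ℕ) (pk c c' : Data) : Logged Data := do
  let r ← loggedToss S n
  return S.addC n pk c c' r

def mulL (n : ℕ) (pk c c' : Data) : Logged Data := do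
  let r ← loggedToss S n
  return S.mulC n pk c c' r

/-- Encrypted value of `b + ∑ wⱼ xⱼ`, from the encryptions `c` of the `xⱼ`. -/
def rowF (n : ℕ) (pk : Data) (w : List (R n)) (b : R n) (c : List Data) : Logged Data := do
  let start ← encL S n pk b
  (w.zip c).foldlM (fun acc wc => do
    let e ← encL S n pk wc.1
    let t ← mulL S n pk e wc.2
    addL S n pk acc t) start

/-- Homomorphic matrix computation. -/
def matF (n : ℕ) (pk : Data) {k m : ℕ} (W : Matrix (Fin m) (Fin k) (R n)) (b : Fin m → R n)
    (c : List Data) : Logged (List Data) :=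
  (List.finRange m).mapM fun i => rowF S n pk (List.ofFn (W i)) (b i) c

/-- Horner evaluation of the polynomial with coefficients `a` at an encrypted point. -/
def hornerF (n : ℕ) (pk : Data) (a : List (R n)) (c : Data) : Logged Data := do
  let start ← encL S n pk 0
  a.reverse.foldlM (fun acc aj => do
    let t ← mulL S n pk acc c
    let e ← encL S n pk aj
    addL S n pk e t) start

/-- Homomorphic polynomial approximation of the activation, in every coordinate. -/
def polyF (n : ℕ) (pk : Data) (a : List (R n)) (c : List Data) : Logged (List Data) :=
  c.mapM (hornerF S n pk a)

/-- All of the server's computation. -/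
def serverF (n : ℕ) (pk : Data) : {k m : ℕ} → Net (R n) k m → List Data → Logged (List Data)
  | _, _, .last W b, c => matF S n pk W b c
  | _, _, .hidden W b a rest, c => do
      let z ← matF S n pk W b c
      let h ← polyF S n pk (List.ofFn a) z
      serverF n pk rest h

end Server

/-! ### Security of two-party protocols against semi-honest adversaries -/

/-- What an execution produces. The view of a party consists of its input, the outcomes of its coin
tosses and the messages that it receives. -/
structure Execution where
  clientView : Data
  serverView : Data
  clientOutput : Data

/-- A protocol between a client and a server, with the functionality it is meant to compute; only the
client has an output. -/
structure TwoParty where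
  /-- Pairs of inputs of the two parties, for a security parameter. -/
  Inputs : ℕ → Type
  clientInput : ∀ n, Inputs n → Data
  serverInput : ∀ n, Inputs n → Data
  /-- The output that the functionality prescribes. -/
  result : ∀ n, Inputs n → Data
  exec : ∀ n, Inputs n → PMF Execution

namespace TwoParty

variable (P : TwoParty)

/-- Input pairs of polynomial length, one for each security parameter. -/
def Admissible (I : ∀ n, P.Inputs n) : Prop :=
  PolySize (fun n => P.clientInput n (I n)) ∧ PolySize (fun n => P.serverInput n (I n))

/-- The client outputs the prescribed result, up to a negligible probability of error. -/
def Correct : Prop :=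
  ∀ I : ∀ n, P.Inputs n, P.Admissible I →
    Negligible fun n =>
      ((P.exec n (I n)).toOuterMeasure {e | e.clientOutput ≠ P.result n (I n)}).toReal

/-- The client's view can be simulated from the client's input and output. -/
def ClientSimulatable : Prop :=
  ∃ sim : Data → PMF Data, PPT sim ∧ ∀ I : ∀ n, P.Inputs n, P.Admissible I →
    CompIndist (fun n => (P.exec n (I n)).map Execution.clientView)
      (fun n => sim (Data.list [P.clientInput n (I n), P.result n (I n)]))

/-- The server's view can be simulated from the server's input. -/
def ServerSimulatable : Prop :=
  ∃ sim : Data → PMF Data, PPT sim ∧ ∀ I : ∀ n, P.Inputs n, P.Admissible I →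
    CompIndist (fun n => (P.exec n (I n)).map Execution.serverView)
      (fun n => sim (P.serverInput n (I n)))

/-- The protocol privately computes its functionality in the presence of a semi-honest client or a
semi-honest server. -/
def SecureSemiHonest : Prop :=
  P.Correct ∧ P.ClientSimulatable ∧ P.ServerSimulatable

end TwoParty

/-! ### The protocol -/

/-- The client's vector and the server's network. -/
structure Inference (A : Type) where
  k : ℕ
  m : ℕ
  x : Fin k → A
  net : Net A k m

section Protocol

variable {R : ℕ → Type} [∀ n, CommRing (R n)] (S : HEScheme R)

def clientInput (n : ℕ) (I : Inference (R n)) : Data :=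
  Data.list [Data.unary n, Data.unary I.k, Data.unary I.m,
    Data.list (List.ofFn fun j => S.code n (I.x j))]

def serverInput (n : ℕ) (I : Inference (R n)) : Data :=
  Data.list [Data.unary n, Data.unary I.k, Data.unary I.m, I.net.code (S.code n)]

/-- The client generates a key pair and sends the public key and the encrypted input; the server
evaluates its network by means of MatF and PolyF and sends the encrypted result; the client decrypts. -/
def execution (n : ℕ) (I : Inference (R n)) : PMF Execution := do
  let rK ← S.toss n
  let rE ← PMF.uniformOfFintype (Fin I.k → S.Coin n)
  let pk := S.pk n rK
  let c : List Data := List.ofFn fun j => S.encrypt n pk (I.x j) (rE j)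
  let (c', log) ← (serverF S n pk I.net c).run []
  return {
    clientView := Data.list [clientInput S n I,
      Data.list [Data.bits rK, Data.list (List.ofFn fun j => Data.bits (rE j))],
      Data.list c']
    serverView := Data.list [serverInput S n I, Data.list log, Data.list [pk, Data.list c]]
    clientOutput := Data.list (c'.map (S.decrypt n (S.sk n rK))) }

/-- The PROUD protocol over the homomorphic cryptosystem `S`. -/
def protocol : TwoParty where
  Inputs n := Inference (R n)
  clientInput := clientInput S
  serverInput := serverInput S
  result n I := Data.list (List.ofFn fun i => S.code n (I.net.eval I.x i))
  exec := execution S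

end Protocol

end Proud

end

noncomputable section

namespace Proud

/-! ### Polynomial bounds -/

/-! Correctness and the client's side are purely statistical. Function privacy speaks only of fresh
operands, but one operation outputs a ciphertext that is `ε`-close to a fresh one, whose randomness
has nothing to do with the operands. It may therefore be replaced by a fresh one before the next
operation (`LClose.bind_const`), and the errors add up. Following this through MatF, PolyF and the
layers (`OpsClose.serverF`), the returned ciphertexts are within `N.tosses * ε` of independent fresh
encryptions of the entries of N(x). These decrypt correctly (`close_clientOutput`), and anyone who
knows N(x) and the key can produce them, which is what the client's simulator does
(`close_clientView`, `clientSim_eq`).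

The server sees the public key, the encrypted input and its own coins. The number of its coin
strings depends only on the shape of the network, so they are independent of what the client sends
(`serverView_eq`). The simulator reads this number off the code of the network (`len_netTosses`) and
encrypts zeros in place of x. A hybrid argument over the coordinates compares this with the real
view (`exists_challenge`): a good distinguisher yields, for each n, two neighbouring hybrids and
fixed values of all other coins between which it still distinguishes. Since distinguishers take
advice, these choices are hardwired, and the reduction `embed` to semantic security stays
deterministic (`compIndist_serverViewD`).

Simulators and reduction must also be actual programs with a step bound. `PPT.exists_computes` turns
a program into a subroutine without side effects; composition, pairing and list loops (`PPT.bind`,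
`PPT.pair`, `PPT.fold`, `PPT.mapD`) are then built once, and everything later is assembled from
them. -/

theorem eval_mono (P : Polynomial ℕ) {a b : ℕ} (h : a ≤ b) : P.eval a ≤ P.eval b := by
  induction P using Polynomial.induction_on' with
  | add p q hp hq => simpa using add_le_add hp hq
  | monomial n c => simpa using Nat.mul_le_mul_left c (Nat.pow_le_pow_left h n)

theorem exists_eval_le_pow (P : Polynomial ℕ) : ∃ k : ℕ, ∀ n : ℕ, P.eval n ≤ n ^ k + k := by
  -- From 2 on, coefficients are absorbed into the exponent, since `c ≤ n ^ c`; the arguments 0 and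
  -- 1, where powers do not grow, are left to the additive constant.
  have key : ∀ P : Polynomial ℕ, ∃ e C : ℕ, P.eval 0 ≤ C ∧ P.eval 1 ≤ C ∧
      ∀ n, 2 ≤ n → P.eval n ≤ n ^ e := by
    intro P
    induction P using Polynomial.induction_on' with
    | add p q hp hq =>
      obtain ⟨e, C, h0, h1, h⟩ := hp
      obtain ⟨e', C', h0', h1', h'⟩ := hq
      refine ⟨max e e' + 1, C + C', by simpa using add_le_add h0 h0',
        by simpa using add_le_add h1 h1', fun n hn => ?_⟩
      have a := (h n hn).trans (Nat.pow_le_pow_right (by omega) (le_max_left e e'))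
      have b := (h' n hn).trans (Nat.pow_le_pow_right (by omega) (le_max_right e e'))
      rw [Polynomial.eval_add, pow_succ]
      nlinarith [Nat.mul_le_mul_left (n ^ max e e') hn]
    | monomial m c =>
      refine ⟨m + c, c, ?_, by simp, fun n hn => ?_⟩
      · rcases Nat.eq_zero_or_pos m with rfl | hm
        · simp
        · simp [hm.ne']
      · have : c ≤ n ^ c := (Nat.lt_pow_self (by omega)).le
        rw [Polynomial.eval_monomial, pow_add, mul_comm]
        exact Nat.mul_le_mul_left _ this
  obtain ⟨e, C, h0, h1, h⟩ := key P
  refine ⟨e + C + 1, fun n => ?_⟩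
  rcases Nat.lt_or_ge n 2 with hn | hn
  · interval_cases n
    · omega
    · rw [one_pow]; omega
  · have a := h n hn
    have b := Nat.pow_le_pow_right (show 0 < n by omega) (show e ≤ e + C + 1 by omega)
    omega

theorem polySize_of_eval {a b : ℕ → Data} (hb : PolySize b) (P : Polynomial ℕ)
    (h : ∀ n, (a n).size ≤ P.eval ((b n).size)) : PolySize a := by
  obtain ⟨k, hk⟩ := hb
  obtain ⟨l, hl⟩ := exists_eval_le_pow (P.comp (Polynomial.X ^ k + Polynomial.C k))
  refine ⟨l, fun n => (h n).trans (le_trans ?_ (hl n))⟩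
  rw [Polynomial.eval_comp]
  exact eval_mono P (by simpa using hk n)

/-! ### Runs of programs -/

namespace Data

@[simp] theorem hd_cons (a b : Data) : (cons a b).hd = a := rfl

@[simp] theorem tl_cons (a b : Data) : (cons a b).tl = b := rfl

theorem size_pos (d : Data) : 0 < d.size := by cases d <;> simp [size]

theorem size_hd_le (d : Data) : d.hd.size ≤ d.size := by cases d <;> simp [size, hd]; omega

theorem size_tl_le (d : Data) : d.tl.size ≤ d.size := by cases d <;> simp [size, tl]

end Data

/-- An assignment costs as much as the value it writes, so a value is either old or has been paid
for. This makes outputs of polynomial-time programs polynomially long. -/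
theorem Runs.size_le {p : Prog} {σ : State} {t : ℕ} {μ : PMF State} (h : Runs p σ t μ) :
    ∀ τ ∈ μ.support, ∀ x, (τ x).size ≤ max (σ x).size t := by
  induction h with
  | skip σ => intro τ hτ x; simp at hτ; simp [hτ]
  | assign y e σ =>
    intro τ hτ x
    simp at hτ
    subst hτ
    by_cases hx : x = y
    · subst hx; simp
    · simp [hx]
  | flip y σ =>
    intro τ hτ x
    simp at hτ
    by_cases hx : x = y
    · subst hx
      rcases hτ with rfl | rfl <;> simp [Data.bit, Data.size]
    · rcases hτ with rfl | rfl <;> simp [hx]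
  | seq _ _ ih₁ ih₂ =>
    intro τ hτ x
    rw [PMF.mem_support_bind_iff] at hτ
    obtain ⟨ρ, hρ, hτ⟩ := hτ
    have := ih₁ ρ hρ x
    have := ih₂ ρ hρ τ hτ x
    omega
  | ite_true _ _ ih => intro τ hτ x; have := ih τ hτ x; omega
  | ite_false _ _ ih => intro τ hτ x; have := ih τ hτ x; omega
  | loop_done _ => intro τ hτ x; simp at hτ; simp [hτ]
  | loop_step _ _ ih => intro τ hτ x; have := ih τ hτ x; omega
  | mono _ _ ih => intro τ hτ x; have := ih τ hτ x; omega

/-- All variables of the expression are below this number. -/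
def Expr.width : Expr → ℕ
  | nil => 0
  | var y => y + 1
  | cons y z => max (y + 1) (z + 1)
  | hd y => y + 1
  | tl y => y + 1

/-- All variables of the program are below this number. -/
def Prog.width : Prog → ℕ
  | skip => 0
  | assign x e => max (x + 1) e.width
  | flip x => x + 1
  | seq p q => max p.width q.width
  | ite x p q => max (x + 1) (max p.width q.width)
  | loop x p => max (x + 1) p.width

theorem Expr.eval_congr {e : Expr} {N : ℕ} (he : e.width ≤ N) {σ σ' : State}
    (h : ∀ i < N, σ' i = σ i) : e.eval σ' = e.eval σ := by
  cases e <;> simp [Expr.width, Expr.eval] at * <;> grind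

/-- The state `τ` below `N` and the state `σ` from `N` on. -/
def State.merge (N : ℕ) (τ σ : State) : State := fun i => if i < N then τ i else σ i

theorem State.merge_update {N x : ℕ} (hx : x < N) (τ σ : State) (d : Data) :
    State.merge N (Function.update τ x d) σ = Function.update (State.merge N τ σ) x d := by
  funext i
  simp only [State.merge, Function.update_apply]
  grind

theorem State.merge_eq {N : ℕ} {τ σ : State} (h : ∀ i < N, σ i = τ i) :
    State.merge N τ σ = σ := by
  funext i
  simp only [State.merge]
  grind

theorem Runs.support_eq_of_le {p : Prog} {σ : State} {t : ℕ} {μ : PMF State} (h : Runs p σ t μ) :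
    ∀ i, p.width ≤ i → ∀ τ ∈ μ.support, τ i = σ i := by
  induction h with
  | skip σ => intro i hi τ hτ; simp at hτ; simp [hτ]
  | assign y e σ =>
    intro i hi τ hτ
    simp [Prog.width] at hτ hi
    subst hτ
    exact Function.update_of_ne (by omega) _ _
  | flip y σ =>
    intro i hi τ hτ
    simp [Prog.width] at hτ hi
    rcases hτ with rfl | rfl <;> exact Function.update_of_ne (by omega) _ _
  | seq _ _ ih₁ ih₂ =>
    intro i hi τ hτ
    rw [PMF.mem_support_bind_iff] at hτ
    obtain ⟨ρ, hρ, hτ⟩ := hτ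
    simp [Prog.width] at hi
    rw [ih₂ ρ hρ i hi.2 τ hτ, ih₁ i hi.1 ρ hρ]
  | ite_true _ _ ih => intro i hi; simp [Prog.width] at hi; exact ih i hi.2.1
  | ite_false _ _ ih => intro i hi; simp [Prog.width] at hi; exact ih i hi.2.2
  | loop_done _ => intro i hi τ hτ; simp at hτ; simp [hτ]
  | loop_step _ _ ih => intro i hi; simp [Prog.width] at hi ih; exact ih i hi.1 hi.2
  | mono _ _ ih => exact ih

/-- Frame property: a program neither reads nor writes beyond its width, so it behaves the same in
any state that agrees with `σ` there, and leaves the rest alone. -/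
theorem Runs.merge {p : Prog} {σ : State} {t : ℕ} {μ : PMF State} (h : Runs p σ t μ) {N : ℕ} :
    p.width ≤ N → ∀ σ' : State, (∀ i < N, σ' i = σ i) →
      Runs p σ' t (μ.map fun τ => State.merge N τ σ') := by
  induction h with
  | skip σ =>
    intro _ σ' h
    rw [PMF.pure_map, State.merge_eq h]
    exact .skip σ'
  | assign y e σ =>
    intro hp σ' h
    simp [Prog.width] at hp
    have he := e.eval_congr hp.2 h
    rw [PMF.pure_map, State.merge_update (by omega), State.merge_eq h, ← he]
    exact .assign y e σ'
  | flip y σ =>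
    intro hp σ' h
    simp [Prog.width] at hp
    rw [PMF.map_comp]
    convert Runs.flip y σ' using 3 with b
    simp [State.merge_update (show y < N by omega), State.merge_eq h]
  | @seq p q σ s t μ ν hr hr' ih₁ ih₂ =>
    intro hp σ' h
    simp [Prog.width] at hp
    -- The run of `q` is known only from states reached from `σ`. Such a state can be recovered from
    -- its merged version, because `p` left the variables from `N` on as they were in `σ`.
    have h₂ : ∀ τ ∈ μ.support, State.merge N (State.merge N τ σ') σ = τ := by
      intro τ hτ
      funext i
      simp only [State.merge]
      split_ifs with hi
      · rfl
      · exact (hr.support_eq_of_le i (by omega) τ hτ).symm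
    have := Runs.seq (q := q) (t := t) (ih₁ hp.1 σ' h) (ν := fun τ =>
      (ν (State.merge N τ σ)).map fun ρ => State.merge N ρ τ) (by
        intro τ' hτ'
        rw [PMF.mem_support_map_iff] at hτ'
        obtain ⟨τ, hτ, rfl⟩ := hτ'
        simp only [h₂ τ hτ]
        apply ih₂ τ hτ hp.2
        intro i hi
        simp [State.merge, hi])
    convert this using 1
    rw [PMF.map_bind, PMF.bind_map]
    ext ρ
    simp only [PMF.bind_apply, Function.comp]
    refine tsum_congr fun τ => ?_
    by_cases hτ : τ ∈ μ.support
    · rw [h₂ τ hτ]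
      congr 3
      funext ρ i
      simp only [State.merge]
      split_ifs <;> rfl
    · rw [PMF.mem_support_iff, not_not] at hτ
      simp [hτ]
  | ite_true hx _ ih =>
    intro hp σ' h
    simp [Prog.width] at hp
    exact .ite_true (by rwa [h _ (by omega)]) (ih hp.2.1 σ' h)
  | ite_false hx _ ih =>
    intro hp σ' h
    simp [Prog.width] at hp
    exact .ite_false (by rwa [h _ (by omega)]) (ih hp.2.2 σ' h)
  | loop_done hx =>
    intro hp σ' h
    simp [Prog.width] at hp
    rw [PMF.pure_map, State.merge_eq h]
    exact .loop_done (by rwa [h _ (by omega)])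
  | loop_step hx _ ih =>
    intro hp σ' h
    simp [Prog.width] at hp ih
    exact .loop_step (by rwa [h _ (by omega)]) (ih hp.1 hp.2 σ' h)
  | mono _ hst ih => intro hp σ' h; exact .mono (ih hp σ' h) hst

theorem Runs.assign_of_eq {x : ℕ} {e : Expr} {σ τ : State} {t : ℕ}
    (hτ : τ = Function.update σ x (e.eval σ)) (ht : (e.eval σ).size ≤ t) :
    Runs (Prog.assign x e) σ t (PMF.pure τ) :=
  hτ ▸ (Runs.assign x e σ).mono ht

theorem Runs.seq_pure {p q : Prog} {σ τ : State} {s t : ℕ} {μ : PMF State}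
    (hp : Runs p σ s (PMF.pure τ)) (hq : Runs q τ t μ) : Runs (Prog.seq p q) σ (s + t) μ := by
  have := Runs.seq hp (ν := fun _ => μ) (t := t) (q := q) (by intro ρ hρ; simp at hρ; rwa [hρ])
  rwa [PMF.bind_const] at this

theorem Runs.seq_update {p q : Prog} {σ ρ : State} {s t : ℕ} {X : PMF Data}
    {Y : Data → PMF State} (hp : Runs p σ s (X.map (Function.update ρ 0)))
    (hq : ∀ a ∈ X.support, Runs q (Function.update ρ 0 a) t (Y a)) :
    Runs (Prog.seq p q) σ (s + t) (X.bind Y) := by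
  have := Runs.seq hp (ν := fun τ => Y (τ 0)) (t := t) (q := q) (by
    intro τ hτ
    rw [PMF.mem_support_map_iff] at hτ
    obtain ⟨a, ha, rfl⟩ := hτ
    simpa using hq a ha)
  rw [PMF.bind_map] at this
  convert this using 2
  funext a
  simp

/-! ### Programs as subroutines -/

/-- The program `p` replaces the contents `d` of variable `0` by a sample of `A d` and changes
nothing else, provided that the variables `1, …, N - 1` are `nil`. -/
def Computes (N : ℕ) (p : Prog) (A : Data → PMF Data) (P : Polynomial ℕ) : Prop :=
  ∀ σ : State, (∀ i, 0 < i → i < N → σ i = Data.nil) →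
    Runs p σ (P.eval (σ 0).size) ((A (σ 0)).map (Function.update σ 0))

/-- Empties the variables `1, …, N`. -/
def clearVars : ℕ → Prog
  | 0 => .skip
  | N + 1 => .seq (clearVars N) (.assign (N + 1) .nil)

theorem runs_clearVars (N : ℕ) (σ : State) :
    Runs (clearVars N) σ (N + 1)
      (PMF.pure fun i => if 0 < i ∧ i ≤ N then Data.nil else σ i) := by
  induction N with
  | zero =>
    change Runs .skip σ 1 _
    convert Runs.skip σ using 2
    funext i
    grind
  | succ N ih =>
    have := ih.seq_pure (Runs.assign_of_eq (x := N + 1) (e := .nil) rfl (t := 1)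
      (by simp [Expr.eval, Data.size]))
    change Runs (.seq (clearVars N) (.assign (N + 1) .nil)) σ (N + 1 + 1) _
    convert this using 2
    funext i
    simp only [Function.update_apply, Expr.eval]
    grind

theorem Computes.mono {N M : ℕ} {p : Prog} {A : Data → PMF Data} {P : Polynomial ℕ}
    (h : Computes N p A P) (hNM : N ≤ M) : Computes M p A P :=
  fun σ hσ => h σ fun i hi hi' => hσ i hi (by omega)

theorem Computes.ppt {N : ℕ} {p : Prog} {A : Data → PMF Data} {P : Polynomial ℕ}
    (h : Computes N p A P) : PPT A := by
  obtain ⟨k, hk⟩ := exists_eval_le_pow P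
  refine ⟨p, k, fun d => ⟨_, _, h (initState d) (by intro i hi _; simp [initState, hi.ne']), ?_,
    hk _⟩⟩
  rw [PMF.map_comp]
  have : (fun σ : State => σ 0) ∘ Function.update (initState d) 0 = id := by funext a; simp
  rw [this, PMF.map_id]
  simp [initState]

/-- Clearing the scratch variables after the run removes side effects, and the frame property
protects everything above. The freedom in `M` lets several subroutines share one bound. -/
theorem PPT.exists_computes {A : Data → PMF Data} (h : PPT A) :
    ∃ p N P, ∀ M, N ≤ M → Computes M p A P := by
  obtain ⟨p, k, h⟩ := h
  -- With `width + 1` the input variable 0 lies in the merged region even if the program mentions no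
  -- variable.
  refine ⟨.seq p (clearVars (p.width)), p.width + 1,
    Polynomial.X ^ k + Polynomial.C k + Polynomial.C (p.width + 1), fun M hM => Computes.mono ?_ hM⟩
  intro σ hσ
  obtain ⟨t, μ, hr, hA, ht⟩ := h (σ 0)
  have h₁ := (hr.mono ht).merge (N := p.width + 1) (by omega) σ (by
    intro i hi
    by_cases h0 : i = 0
    · simp [initState, h0]
    · simp [initState, h0, hσ i (by omega) hi])
  have h₂ := Runs.seq h₁ (fun τ _ => runs_clearVars p.width τ)
  convert h₂ using 1
  · simp [add_assoc]
  · rw [← hA, PMF.map_comp, PMF.bind_map]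
    change _ = μ.bind (PMF.pure ∘ _)
    rw [PMF.bind_pure_comp]
    congr 1
    funext τ i
    simp only [State.merge, Function.comp, Function.update_apply]
    grind

theorem PPT.exists_size_le {A : Data → PMF Data} (h : PPT A) :
    ∃ P : Polynomial ℕ, ∀ d, ∀ a ∈ (A d).support, a.size ≤ P.eval d.size := by
  obtain ⟨p, N, P, h⟩ := h.exists_computes
  refine ⟨P + Polynomial.X, fun d a ha => ?_⟩
  have := (h N le_rfl (initState d) (by intro i hi _; simp [initState, hi.ne'])).size_le
    (Function.update (initState d) 0 a)
    (by rw [PMF.mem_support_map_iff]; exact ⟨a, by simpa [initState] using ha, rfl⟩) 0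
  simp [initState] at this ⊢
  omega

theorem PolyTime.exists_size_le {f : Data → Data} (h : PolyTime f) :
    ∃ P : Polynomial ℕ, ∀ d, (f d).size ≤ P.eval d.size := by
  obtain ⟨P, hP⟩ := PPT.exists_size_le h
  exact ⟨P, fun d => hP d _ (by simp)⟩

/-! ### Closure properties of polynomial time -/

/-- The second program is charged in terms of the intermediate value, whose size is polynomial in
that of the input; hence the composed bound `Q.comp S`. -/
theorem PPT.bind {A B : Data → PMF Data} (hA : PPT A) (hB : PPT B) :
    PPT fun d => (A d).bind B := by
  obtain ⟨S, hS⟩ := hA.exists_size_le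
  obtain ⟨p, N, P, hp⟩ := hA.exists_computes
  obtain ⟨q, M, Q, hq⟩ := hB.exists_computes
  refine Computes.ppt (N := max N M) (p := .seq p q) (P := P + Q.comp S) fun σ hσ => ?_
  have h := (hp _ (le_max_left N M) σ hσ).seq_update (q := q) (t := (Q.comp S).eval (σ 0).size)
    (Y := fun a => (B a).map (Function.update σ 0)) (by
      intro a ha
      have := hq _ (le_max_right N M) (Function.update σ 0 a) (by
        intro i hi hi'
        rw [Function.update_of_ne hi.ne']
        exact hσ i hi hi')
      simp only [Function.update_self] at this
      rw [show Function.update (Function.update σ 0 a) 0 = Function.update σ 0 by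
        funext b; simp] at this
      refine this.mono ?_
      rw [Polynomial.eval_comp]
      exact eval_mono Q (hS _ a ha))
  rw [Polynomial.eval_add, PMF.map_bind]
  exact h

/-- The input is kept in variable `N` while `p` runs and the first result in `N + 1` while `q` runs,
out of reach of both; at the end both are emptied. -/
theorem PPT.pair {A B : Data → PMF Data} (hA : PPT A) (hB : PPT B) :
    PPT fun d => (A d).bind fun a => (B d).map (Data.cons a) := by
  obtain ⟨S, hS⟩ := hA.exists_size_le
  obtain ⟨T, hT⟩ := hB.exists_size_le
  obtain ⟨p, N₁, P, hp⟩ := hA.exists_computes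
  obtain ⟨q, N₂, Q, hq⟩ := hB.exists_computes
  -- The added 1 keeps the storage variable `N` distinct from the input variable 0.
  set N := max N₁ N₂ + 1 with hN
  refine Computes.ppt (N := N + 2)
    (p := .seq (.assign N (.var 0)) (.seq p (.seq (.assign (N + 1) (.var 0))
      (.seq (.assign 0 (.var N)) (.seq (.assign N .nil) (.seq q
        (.seq (.assign 0 (.cons (N + 1) 0)) (.assign (N + 1) .nil))))))))
    (P := Polynomial.X + (P + (S + (Polynomial.X + (1 + (Q + (1 + S + T + 1)))))))
    fun σ hσ => ?_
  have hpN := hp N (by omega)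
  have hqN := hq N (by omega)
  have hN0 : N ≠ 0 := by omega
  clear_value N
  set d := σ 0 with hd
  have h₁ : Runs (.assign N (.var 0)) σ d.size (.pure (Function.update σ N d)) :=
    .assign_of_eq rfl le_rfl
  have h₂ := hpN (Function.update σ N d) (by
    intro i hi hi'
    rw [Function.update_of_ne (by omega)]
    exact hσ i hi (by omega))
  rw [Function.update_of_ne hN0.symm, ← hd] at h₂
  simp only [Polynomial.eval_add, PMF.map_bind, Polynomial.eval_X, Polynomial.eval_one]
  refine h₁.seq_pure (h₂.seq_update fun a ha => ?_)
  refine Runs.seq_pure (τ := Function.update (Function.update (Function.update σ N d) 0 a) (N + 1) a)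
    (.assign_of_eq (by simp [Expr.eval]) (by simpa [Expr.eval] using hS d a ha)) ?_
  refine Runs.seq_pure (τ := Function.update (Function.update σ N d) (N + 1) a)
    (.assign_of_eq ?_ (by simp [Expr.eval, hN0])) ?_
  · funext i
    simp only [Function.update_apply, Expr.eval]
    grind
  refine Runs.seq_pure (τ := Function.update σ (N + 1) a)
    (.assign_of_eq ?_ (by simp [Expr.eval, Data.size])) ?_
  · funext i
    simp only [Function.update_apply, Expr.eval]
    have := hσ N (by omega) (by omega)
    grind
  have h₃ := hqN (Function.update σ (N + 1) a) (by
    intro i hi hi'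
    rw [Function.update_of_ne (by omega)]
    exact hσ i hi (by omega))
  rw [Function.update_of_ne (by omega), ← hd] at h₃
  rw [PMF.map_comp, ← PMF.bind_pure_comp]
  refine h₃.seq_update fun b hb => ?_
  refine Runs.seq_pure (τ := Function.update (Function.update σ (N + 1) a) 0 (.cons a b))
    (.assign_of_eq (by simp [Expr.eval]) ?_) (.assign_of_eq ?_ (by simp [Expr.eval, Data.size]))
  · simp [Expr.eval, Data.size]
    have := hS d a ha
    have := hT d b hb
    omega
  · funext i
    simp only [Function.update_apply, Expr.eval]
    have := hσ (N + 1) (by omega) (by omega)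
    grind

theorem PolyTime.of_expr (e : Expr) (h : e.width ≤ 1)
    (hs : ∀ σ, (e.eval σ).size ≤ (σ 0).size + (σ 0).size) :
    PolyTime fun d => e.eval (initState d) := by
  refine Computes.ppt (N := 1) (p := .assign 0 e) (P := Polynomial.X + Polynomial.X)
    fun σ _ => ?_
  rw [PMF.pure_map]
  refine .assign_of_eq ?_ (by simpa using hs σ)
  rw [e.eval_congr h (σ := initState (σ 0)) (σ' := σ)]
  intro i hi
  simp [initState, show i = 0 by omega]

theorem PolyTime.id : PolyTime fun d => d :=
  PolyTime.of_expr (.var 0) (by simp [Expr.width]) (by simp [Expr.eval])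

theorem PolyTime.nil : PolyTime fun _ => Data.nil :=
  PolyTime.of_expr .nil (by simp [Expr.width]) (by
    intro σ
    have := (σ 0).size_pos
    simp [Expr.eval, Data.size]
    omega)

theorem PPT.comp {A : Data → PMF Data} {f : Data → Data} (hA : PPT A) (hf : PolyTime f) :
    PPT fun d => A (f d) := by
  simpa using PPT.bind hf hA

theorem PPT.map {A : Data → PMF Data} {f : Data → Data} (hA : PPT A) (hf : PolyTime f) :
    PPT fun d => (A d).map f := by
  simpa [← PMF.bind_pure_comp, Function.comp_def] using PPT.bind hA hf

/-- Keeps the input available to the second stage. Iterated, it builds an environment that holds all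
earlier samples, which is how the simulators are assembled. -/
theorem PPT.bind_input {A B : Data → PMF Data} (hA : PPT A) (hB : PPT B) :
    PPT fun d => (A d).bind fun a => B (Data.cons d a) := by
  have := (PPT.pair PolyTime.id hA).bind hB
  simpa [PMF.bind_map, Function.comp_def] using this

theorem PPT.map_input {A : Data → PMF Data} {f : Data → Data} (hA : PPT A) (hf : PolyTime f) :
    PPT fun d => (A d).map fun a => f (Data.cons d a) := by
  simpa [← PMF.bind_pure_comp, Function.comp_def] using PPT.bind_input hA hf

theorem PolyTime.comp {f g : Data → Data} (hf : PolyTime f) (hg : PolyTime g) :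
    PolyTime fun d => f (g d) :=
  PPT.comp (A := fun d => PMF.pure (f d)) hf hg

theorem PolyTime.hd {f : Data → Data} (hf : PolyTime f) : PolyTime fun d => (f d).hd :=
  PolyTime.comp (f := fun d => d.hd) (PolyTime.of_expr (.hd 0) (by simp [Expr.width]) (by
    intro σ
    have := (σ 0).size_hd_le
    simp [Expr.eval]
    omega)) hf

theorem PolyTime.tl {f : Data → Data} (hf : PolyTime f) : PolyTime fun d => (f d).tl :=
  PolyTime.comp (f := fun d => d.tl) (PolyTime.of_expr (.tl 0) (by simp [Expr.width]) (by
    intro σ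
    have := (σ 0).size_tl_le
    simp [Expr.eval]
    omega)) hf

theorem PolyTime.cons {f g : Data → Data} (hf : PolyTime f) (hg : PolyTime g) :
    PolyTime fun d => Data.cons (f d) (g d) := by
  simpa [PolyTime, PMF.pure_map] using PPT.pair hf hg

theorem PolyTime.list_nil : PolyTime fun _ => Data.list [] := PolyTime.nil

theorem PolyTime.list_cons {f : Data → Data} {l : Data → List Data} (hf : PolyTime f)
    (hl : PolyTime fun d => Data.list (l d)) : PolyTime fun d => Data.list (f d :: l d) :=
  PolyTime.cons hf hl

/-- The test for `nil`. -/
def Data.select (c a b : Data) : Data :=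
  match c with
  | nil => b
  | cons _ _ => a

theorem PolyTime.select {c f g : Data → Data} (hc : PolyTime c) (hf : PolyTime f)
    (hg : PolyTime g) : PolyTime fun d => Data.select (c d) (f d) (g d) := by
  have h : PolyTime fun d => Data.select d.hd d.tl.hd d.tl.tl := by
    refine Computes.ppt (N := 2)
      (p := .seq (.assign 1 (.hd 0)) (.seq (.assign 0 (.tl 0))
        (.ite 1 (.seq (.assign 1 .nil) (.assign 0 (.hd 0))) (.assign 0 (.tl 0)))))
      (P := Polynomial.X + (Polynomial.X + (1 + Polynomial.X + 1))) fun σ hσ => ?_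
    simp only [PMF.pure_map, Polynomial.eval_add, Polynomial.eval_X, Polynomial.eval_one]
    have h₁ := (σ 0).size_hd_le
    have h₂ := (σ 0).size_tl_le
    have h₃ := (σ 0).tl.size_hd_le
    have h₄ := (σ 0).tl.size_tl_le
    refine Runs.seq_pure (.assign_of_eq rfl (by simpa [Expr.eval])) ?_
    refine Runs.seq_pure (.assign_of_eq rfl (by simpa [Expr.eval])) ?_
    have hσ1 := hσ 1 (by omega) (by omega)
    rcases hc : (σ 0).hd with _ | ⟨a, b⟩
    · refine Runs.ite_false (by simp [Expr.eval, hc]) (.assign_of_eq ?_ ?_)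
      · funext i
        simp only [Function.update_apply, Expr.eval, Data.select]
        grind
      · simp [Expr.eval]
        omega
    · refine Runs.ite_true (by simp [Expr.eval, hc]) (Runs.seq_pure (.assign_of_eq rfl ?_)
        (.assign_of_eq ?_ ?_))
      · simp [Expr.eval, Data.size]
      · funext i
        simp only [Function.update_apply, Expr.eval, Data.select]
        grind
      · simp [Expr.eval]
        omega
  exact h.comp (hc.cons (hf.cons hg))

/-- A random bit. -/
def coinFlip : PMF Data := (PMF.uniformOfFintype Bool).map Data.bit

theorem ppt_coinFlip : PPT fun _ => coinFlip := by
  refine Computes.ppt (N := 1) (p := .flip 0) (P := 3) fun σ _ => ?_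
  rw [coinFlip, PMF.map_comp, show (3 : Polynomial ℕ) = Polynomial.C 3 from rfl,
    Polynomial.eval_C]
  exact Runs.flip 0 σ

/-! ### Loops over lists -/

/-- Runs through the suffixes of a list; the body gets the environment `e`, the current suffix and
the accumulator. -/
def foldD (B : Data → PMF Data) (e : Data) : Data → Data → PMF Data
  | .nil, s => PMF.pure s
  | .cons a r, s => (B (.cons e (.cons (.cons a r) s))).bind (foldD B e r)

/-- The body of the loop that computes `foldD`. -/
def foldBody (N : ℕ) (p : Prog) : Prog :=
  .seq (.assign 0 (.cons N 0)) (.seq (.assign 0 (.cons (N + 1) 0)) (.seq p (.assign N (.tl N))))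

theorem runs_foldBody {N : ℕ} {p : Prog} {B : Data → PMF Data} {P : Polynomial ℕ}
    (hp : Computes N p B P) (hN : N ≠ 0) {E L M : ℕ} {σ : State}
    (hσ : ∀ i, 0 < i → i < N → σ i = Data.nil) (hE : (σ (N + 1)).size ≤ E)
    (hL : (σ N).size ≤ L) (hM : (σ 0).size ≤ M) :
    Runs (foldBody N p) σ ((1 + L + M) + ((2 + E + L + M) + (P.eval (2 + E + L + M) + L)))
      ((B (.cons (σ (N + 1)) (.cons (σ N) (σ 0)))).map
        (Function.update (Function.update σ N (σ N).tl) 0)) := by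
  refine Runs.seq_pure (.assign_of_eq rfl (by simp [Expr.eval, Data.size]; omega)) ?_
  refine Runs.seq_pure
    (τ := Function.update σ 0 (.cons (σ (N + 1)) (.cons (σ N) (σ 0))))
    (.assign_of_eq (by simp [Expr.eval]) (by simp [Expr.eval, Data.size]; omega)) ?_
  have h := hp (Function.update σ 0 (.cons (σ (N + 1)) (.cons (σ N) (σ 0)))) (by
    intro i hi hi'
    rw [Function.update_of_ne (by omega)]
    exact hσ i hi hi')
  rw [Function.update_self] at h
  rw [← PMF.bind_pure_comp]
  refine (h.mono (eval_mono P ?_)).seq_update fun a _ => .assign_of_eq ?_ ?_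
  · simp [Data.size]
    omega
  · funext i
    simp only [Function.update_apply, Expr.eval]
    grind
  · simp only [Expr.eval, Function.update_of_ne hN]
    exact (σ N).size_tl_le.trans hL

/-- The potential "accumulator size plus remaining suffix size times growth per round" never rises.
So `M` bounds the accumulator throughout, every round has the same cost bound, and the size of the
list bounds the number of rounds. -/
theorem runs_foldLoop {N : ℕ} {p : Prog} {B : Data → PMF Data} {P Q : Polynomial ℕ}
    (hp : Computes N p B P) (hN : N ≠ 0)
    (hQ : ∀ e l s, ∀ a ∈ (B (.cons e (.cons l s))).support,
      a.size ≤ s.size + Q.eval (e.size + l.size)) {E L M : ℕ} (l : Data) :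
    ∀ {σ : State}, σ N = l → (∀ i, 0 < i → i < N → σ i = Data.nil) → (σ (N + 1)).size ≤ E →
      l.size ≤ L → (σ 0).size + l.size * Q.eval (E + L) ≤ M →
      Runs (.loop N (foldBody N p)) σ
        (l.size * ((1 + L + M) + ((2 + E + L + M) + (P.eval (2 + E + L + M) + L)) + 2))
        ((foldD B (σ (N + 1)) l (σ 0)).map (Function.update (Function.update σ N .nil) 0)) := by
  induction l with
  | nil =>
    intro σ hl hσ hE hL hM
    rw [foldD, PMF.pure_map]
    have := (Runs.loop_done (p := foldBody N p) hl)
    refine Runs.mono (s := 1) ?_ (by simp [Data.size])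
    convert this using 2
    funext i
    simp only [Function.update_apply]
    grind
  | cons a r _ ih =>
    intro σ hl hσ hE hL hM
    have hb := runs_foldBody hp hN hσ hE (hl ▸ hL) (M := M) (by omega)
    rw [hl, Data.tl_cons] at hb
    have h := Runs.loop_step (by simp [hl]) (hb.seq_update (q := .loop N (foldBody N p))
      (Y := fun o => (foldD B (σ (N + 1)) r o).map (Function.update (Function.update σ N .nil) 0))
      (t := r.size * ((1 + L + M) + ((2 + E + L + M) + (P.eval (2 + E + L + M) + L)) + 2))
      fun o ho => ?_)
    · rw [foldD, PMF.map_bind]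
      refine h.mono ?_
      simp only [Data.size]
      nlinarith [a.size_pos]
    · have hr : r.size ≤ L := by simp [Data.size] at hL; omega
      have ho' := hQ _ _ _ o ho
      have := eval_mono Q (add_le_add hE hL)
      have hM' : o.size + r.size * Q.eval (E + L) ≤ M := by
        simp only [Data.size] at hM
        nlinarith [a.size_pos]
      have := ih (σ := Function.update (Function.update σ N r) 0 o) (by simp [hN])
        (by
          intro i hi hi'
          rw [Function.update_of_ne (by omega), Function.update_of_ne (by omega)]
          exact hσ i hi hi') (by simpa) hr (by simpa using hM')
      simp only [Function.update_self] at this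
      rw [Function.update_of_ne (by omega), Function.update_of_ne (by omega)] at this
      convert this using 2
      funext b i
      simp only [Function.update_apply]
      grind only

/-- The growth of the accumulator in one round must be additive and bounded through the environment
and the suffix alone: a body that doubled its accumulator would reach exponential size. -/
theorem PPT.fold {B : Data → PMF Data} (hB : PPT B) (Q : Polynomial ℕ)
    (hQ : ∀ e l s, ∀ a ∈ (B (.cons e (.cons l s))).support,
      a.size ≤ s.size + Q.eval (e.size + l.size)) :
    PPT fun d => foldD B d.hd d.tl.hd d.tl.tl := by
  obtain ⟨p, N₁, P, hp⟩ := hB.exists_computes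
  set N := N₁ + 1 with hN
  let X : Polynomial ℕ := Polynomial.X
  let M : Polynomial ℕ := X + X * Q.comp (X + X)
  refine Computes.ppt (N := N + 2)
    (p := .seq (.assign (N + 1) (.hd 0)) (.seq (.assign 0 (.tl 0)) (.seq (.assign N (.hd 0))
      (.seq (.assign 0 (.tl 0)) (.seq (.loop N (foldBody N p)) (.assign (N + 1) .nil))))))
    (P := X + (X + (X + (X + (X * ((1 + X + M) + ((2 + X + X + M) +
      (P.comp (2 + X + X + M) + X)) + 2) + 1))))) fun σ hσ => ?_
  have hpN := hp N (by omega)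
  have hN0 : N ≠ 0 := by omega
  clear_value N
  have e2 (n : ℕ) : Polynomial.eval n (2 : Polynomial ℕ) = 2 := Polynomial.eval_C
  simp only [X, M, Polynomial.eval_add, Polynomial.eval_mul, Polynomial.eval_comp,
    Polynomial.eval_X, Polynomial.eval_one, e2]
  set d := σ 0 with hd
  have h₁ := d.size_hd_le
  have h₂ := d.size_tl_le
  have h₃ := d.tl.size_hd_le
  have h₄ := d.tl.size_tl_le
  refine Runs.seq_pure (τ := Function.update σ (N + 1) d.hd)
    (.assign_of_eq (by simp [Expr.eval, hd]) (by simpa [Expr.eval])) ?_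
  refine Runs.seq_pure (τ := Function.update (Function.update σ (N + 1) d.hd) 0 d.tl)
    (.assign_of_eq (by simp [Expr.eval, hd]) (by simpa [Expr.eval])) ?_
  refine Runs.seq_pure
    (τ := Function.update (Function.update (Function.update σ (N + 1) d.hd) 0 d.tl) N d.tl.hd)
    (.assign_of_eq (by simp [Expr.eval]) (by simp [Expr.eval]; omega)) ?_
  set ρ := Function.update (Function.update (Function.update σ (N + 1) d.hd) N d.tl.hd) 0 d.tl.tl
    with hρ
  refine Runs.seq_pure (τ := ρ) (.assign_of_eq ?_ (by simp [Expr.eval, hN0.symm]; omega)) ?_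
  · funext i
    simp only [hρ, Function.update_apply, Expr.eval]
    grind
  have ρ0 : ρ 0 = d.tl.tl := by simp [ρ]
  have ρN : ρ N = d.tl.hd := by simp [ρ, hN0]
  have ρN1 : ρ (N + 1) = d.hd := by simp [ρ]
  have hloop := runs_foldLoop hpN hN0 hQ (E := d.size) (L := d.size)
    (M := d.size + d.size * Q.eval (d.size + d.size)) d.tl.hd ρN (by
      intro i hi hi'
      simp only [ρ]
      rw [Function.update_of_ne (by omega), Function.update_of_ne (by omega),
        Function.update_of_ne (by omega)]
      exact hσ i hi (by omega)) (by simpa [ρN1]) (by omega) (by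
      rw [ρ0]
      exact add_le_add (by omega) (Nat.mul_le_mul_right _ (by omega)))
  rw [ρ0, ρN1] at hloop
  rw [← PMF.bind_pure_comp]
  refine (hloop.mono (Nat.mul_le_mul_right _ (by omega))).seq_update fun a _ =>
    .assign_of_eq ?_ (by simp [Expr.eval, Data.size])
  funext i
  have := hσ N (by omega) (by omega)
  have := hσ (N + 1) (by omega) (by omega)
  simp only [hρ, Function.update_apply, Expr.eval]
  grind

/-- The deterministic case of `foldD`. -/
def Data.foldWith (f : Data → Data) (e : Data) : Data → Data → Data
  | .nil, s => s
  | .cons a r, s => foldWith f e r (f (.cons e (.cons (.cons a r) s)))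

theorem foldD_pure (f : Data → Data) (e l s : Data) :
    foldD (fun d => PMF.pure (f d)) e l s = PMF.pure (Data.foldWith f e l s) := by
  induction l generalizing s with
  | nil => rfl
  | cons a r _ ih => simp [foldD, ih, Data.foldWith]

theorem PolyTime.foldWith {f x y z : Data → Data} (hf : PolyTime f) (Q : Polynomial ℕ)
    (hQ : ∀ e l s, (f (.cons e (.cons l s))).size ≤ s.size + Q.eval (e.size + l.size))
    (hx : PolyTime x) (hy : PolyTime y) (hz : PolyTime z) :
    PolyTime fun d => Data.foldWith f (x d) (y d) (z d) := by
  have h := PPT.fold hf Q (by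
    intro e l s a ha
    simp only [PMF.support_pure, Set.mem_singleton_iff] at ha
    exact ha ▸ hQ e l s)
  simp only [foldD_pure] at h
  exact PolyTime.comp (f := fun d => Data.foldWith f d.hd d.tl.hd d.tl.tl) h
    (hx.cons (hy.cons hz))

/-- Bounds the growth caused by an inner loop, as needed when one loop is the body of another. -/
theorem Data.size_foldWith_le {f : Data → Data} {Q : Polynomial ℕ}
    (hQ : ∀ e l s, (f (.cons e (.cons l s))).size ≤ s.size + Q.eval (e.size + l.size))
    (e l s : Data) :
    (Data.foldWith f e l s).size ≤ s.size + l.size * Q.eval (e.size + l.size) := by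
  induction l generalizing s with
  | nil => simp [Data.foldWith]
  | cons a r _ ih =>
    have h₁ := ih (f (.cons e (.cons (.cons a r) s)))
    have h₂ := hQ e (.cons a r) s
    have h₃ := eval_mono Q (show e.size + r.size ≤ e.size + (Data.cons a r).size by
      simp [Data.size])
    have h₄ := Nat.mul_le_mul_left r.size h₃
    simp only [Data.foldWith]
    simp only [Data.size] at *
    nlinarith [a.size_pos]

/-! ### List operations obtained from loops -/

/-- The reversal of the first list, followed by the second one. -/
def Data.revAppend : Data → Data → Data
  | .nil, s => s
  | .cons a r, s => revAppend r (.cons a s)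

theorem PolyTime.revAppend {f g : Data → Data} (hf : PolyTime f) (hg : PolyTime g) :
    PolyTime fun d => (f d).revAppend (g d) := by
  have h := PolyTime.foldWith (f := fun d => Data.cons d.tl.hd.hd d.tl.tl)
    (PolyTime.id.tl.hd.hd.cons PolyTime.id.tl.tl) (Polynomial.X + 1) (by
      intro e l s
      have := l.size_hd_le
      simp [Data.size]
      omega) PolyTime.nil hf hg
  have h₁ : ∀ l s, Data.foldWith (fun d => Data.cons d.tl.hd.hd d.tl.tl) .nil l s
      = l.revAppend s := by
    intro l
    induction l with
    | nil => intro s; rfl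
    | cons a r _ ih => intro s; exact ih _
  simpa only [h₁] using h

theorem Data.size_revAppend_le (x s : Data) : (x.revAppend s).size ≤ x.size + s.size := by
  induction x generalizing s with
  | nil => simp [Data.revAppend]
  | cons a r _ ih =>
    have := ih (.cons a s)
    simp only [Data.revAppend, Data.size] at *
    omega

theorem Data.revAppend_list (l m : List Data) :
    (Data.list l).revAppend (Data.list m) = Data.list (l.reverse ++ m) := by
  induction l generalizing m with
  | nil => rfl
  | cons a l ih => simpa [Data.revAppend, Data.list] using ih (a :: m)

theorem Data.exists_list (x : Data) : ∃ l, x = Data.list l := by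
  induction x with
  | nil => exact ⟨[], rfl⟩
  | cons a r _ ih =>
    obtain ⟨l, rfl⟩ := ih
    exact ⟨a :: l, rfl⟩

theorem Data.revAppend_revAppend_nil (x : Data) : (x.revAppend .nil).revAppend .nil = x := by
  obtain ⟨l, rfl⟩ := x.exists_list
  have h₁ := Data.revAppend_list l []
  have h₂ := Data.revAppend_list l.reverse []
  simp only [Data.list, List.append_nil, List.reverse_reverse] at h₁ h₂
  rw [h₁, h₂]

/-- Independent samples of `B (e, a)` for the members `a` of a list. -/
def mapD (B : Data → PMF Data) (e : Data) : Data → PMF Data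
  | .nil => PMF.pure .nil
  | .cons a r => (B (.cons e a)).bind fun b => (mapD B e r).map (Data.cons b)

/-- A loop that conses each new sample onto the accumulator collects them in reverse order; one
final reversal repairs this. -/
theorem PPT.mapD {B : Data → PMF Data} {f g : Data → Data} (hB : PPT B) (hf : PolyTime f)
    (hg : PolyTime g) : PPT fun d => mapD B (f d) (g d) := by
  obtain ⟨P, hP⟩ := hB.exists_size_le
  have h₀ : PPT fun d => (B (.cons d.hd d.tl.hd.hd)).map fun b => Data.cons b d.tl.tl :=
    PPT.map_input (f := fun d => .cons d.tl d.hd.tl.tl)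
      (hB.comp (PolyTime.id.hd.cons PolyTime.id.tl.hd.hd))
      (PolyTime.id.tl.cons PolyTime.id.hd.tl.tl)
  have h := PPT.fold h₀ (P.comp (Polynomial.X + 1) + 1) (by
    intro e l s a ha
    rw [PMF.mem_support_map_iff] at ha
    obtain ⟨b, hb, rfl⟩ := ha
    have h₁ := hP _ b hb
    have h₂ := l.size_hd_le
    have h₃ := eval_mono P (show 1 + e.size + l.hd.size ≤ e.size + l.size + 1 by omega)
    simp [Data.size, Data.hd, Data.tl] at h₁ h₃ ⊢
    omega)
  have h₁ : ∀ l e s, foldD (fun d => (B (.cons d.hd d.tl.hd.hd)).map fun b => Data.cons b d.tl.tl)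
      e l s = (Proud.mapD B e l).map fun x => x.revAppend s := by
    intro l
    induction l with
    | nil => intro e s; simp [foldD, Proud.mapD, PMF.pure_map, Data.revAppend]
    | cons a r _ ih =>
      intro e s
      simp only [foldD, Proud.mapD, Data.hd_cons, Data.tl_cons, PMF.bind_map, PMF.map_bind, PMF.map_comp]
      congr 1
      funext b
      simp only [Function.comp_def, ih, Data.revAppend]
  simp only [h₁] at h
  have h₂ := (h.map (PolyTime.id.revAppend PolyTime.nil)).comp (hf.cons (hg.cons PolyTime.nil))
  simp only [Data.hd, Data.tl, PMF.map_comp, Function.comp_def,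
    Data.revAppend_revAppend_nil] at h₂
  simpa only [show (fun x : Data => x) = id from rfl, PMF.map_id] using h₂

/-- The values `f (e, a)` for the members `a` of a list. -/
def Data.mapWith (f : Data → Data) (e : Data) : Data → Data
  | .nil => .nil
  | .cons a r => .cons (f (.cons e a)) (mapWith f e r)

theorem mapD_pure (f : Data → Data) (e l : Data) :
    mapD (fun d => PMF.pure (f d)) e l = PMF.pure (Data.mapWith f e l) := by
  induction l with
  | nil => rfl
  | cons a r _ ih => simp [mapD, ih, PMF.pure_map, Data.mapWith]

theorem PolyTime.mapWith {f g h : Data → Data} (hf : PolyTime f) (hg : PolyTime g)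
    (hh : PolyTime h) : PolyTime fun d => Data.mapWith f (g d) (h d) := by
  have := PPT.mapD hf hg hh
  simp only [mapD_pure] at this
  exact this

theorem Data.mapWith_list (f : Data → Data) (e : Data) (l : List Data) :
    Data.mapWith f e (Data.list l) = Data.list (l.map fun a => f (.cons e a)) := by
  induction l with
  | nil => rfl
  | cons a l ih => simp [Data.list, Data.mapWith, ih]

/-- The length of a list. -/
def Data.len : Data → ℕ
  | .nil => 0
  | .cons _ r => r.len + 1

theorem Data.len_list (l : List Data) : (Data.list l).len = l.length := by
  induction l with
  | nil => rfl
  | cons a l ih => simp [Data.list, Data.len, ih]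

theorem Data.len_le_size (x : Data) : x.len ≤ x.size := by
  induction x with
  | nil => simp [Data.len]
  | cons a r _ ih => simp [Data.len, Data.size]; omega

theorem Data.len_revAppend (x s : Data) : (x.revAppend s).len = x.len + s.len := by
  induction x generalizing s with
  | nil => simp [Data.revAppend, Data.len]
  | cons a r _ ih => simp [Data.revAppend, Data.len, ih]; omega

/-! ### Statistical distance -/

section Close

variable {α β γ : Type}

/-- One-sided form of statistical distance at most `δ`. -/
def Close (δ : ENNReal) (X Y : PMF α) : Prop :=
  ∀ s : Set α, X.toOuterMeasure s ≤ Y.toOuterMeasure s + δ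

theorem Close.refl (X : PMF α) : Close 0 X X := fun s => by simp

theorem Close.mono {δ δ' : ENNReal} {X Y : PMF α} (h : Close δ X Y) (hδ : δ ≤ δ') :
    Close δ' X Y := fun s => (h s).trans (by gcongr)

theorem toOuterMeasure_le_one (X : PMF α) (s : Set α) : X.toOuterMeasure s ≤ 1 := by
  rw [PMF.toOuterMeasure_apply, ← X.tsum_coe]
  exact ENNReal.tsum_le_tsum fun a => Set.indicator_le_self _ _ _

theorem toOuterMeasure_ne_top (X : PMF α) (s : Set α) : X.toOuterMeasure s ≠ ⊤ :=
  ((toOuterMeasure_le_one X s).trans_lt ENNReal.one_lt_top).ne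

theorem toOuterMeasure_add_compl (X : PMF α) (s : Set α) :
    X.toOuterMeasure s + X.toOuterMeasure sᶜ = 1 := by
  rw [PMF.toOuterMeasure_apply, PMF.toOuterMeasure_apply, ← ENNReal.tsum_add, ← X.tsum_coe]
  exact tsum_congr fun a => congrFun (Set.indicator_self_add_compl s X) a

theorem StatClose.close {ε : ℝ} {X Y : PMF Data} (h : StatClose ε X Y) :
    Close (ENNReal.ofReal ε) X Y := by
  intro s
  have h₁ := (abs_le.1 (h s)).2
  have h₀ := (abs_nonneg _).trans (h s)
  rw [← ENNReal.toReal_le_toReal (toOuterMeasure_ne_top _ _)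
    (ENNReal.add_ne_top.2 ⟨toOuterMeasure_ne_top _ _, ENNReal.ofReal_ne_top⟩),
    ENNReal.toReal_add (toOuterMeasure_ne_top _ _) ENNReal.ofReal_ne_top,
    ENNReal.toReal_ofReal h₀]
  linarith

/-- The missing inequality is the given one for the complementary event. -/
theorem Close.abs_sub_le {δ : ENNReal} {X Y : PMF α} (h : Close δ X Y) (hδ : δ ≠ ⊤) (s : Set α) :
    |(X.toOuterMeasure s).toReal - (Y.toOuterMeasure s).toReal| ≤ δ.toReal := by
  have key : ∀ s, (X.toOuterMeasure s).toReal ≤ (Y.toOuterMeasure s).toReal + δ.toReal := by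
    intro s
    rw [← ENNReal.toReal_add (toOuterMeasure_ne_top _ _) hδ]
    exact ENNReal.toReal_mono (ENNReal.add_ne_top.2 ⟨toOuterMeasure_ne_top _ _, hδ⟩) (h s)
  have compl : ∀ Z : PMF α, (Z.toOuterMeasure s).toReal + (Z.toOuterMeasure sᶜ).toReal = 1 := by
    intro Z
    rw [← ENNReal.toReal_add (toOuterMeasure_ne_top _ _) (toOuterMeasure_ne_top _ _),
      toOuterMeasure_add_compl, ENNReal.toReal_one]
  have h₁ := key s
  have h₂ := key sᶜ
  have h₃ := compl X
  have h₄ := compl Y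
  rw [abs_le]
  constructor <;> linarith

theorem Close.map {δ : ENNReal} {X Y : PMF α} (h : Close δ X Y) (f : α → β) :
    Close δ (X.map f) (Y.map f) := by
  intro s
  simpa only [PMF.toOuterMeasure_map_apply] using h (f ⁻¹' s)

/-- Passes from events to tests with values in [0, 1]. The excess of `X` over `Y` lives on the event
`Y a < X a`, and closeness for that single event bounds its total mass. -/
theorem Close.tsum_mul_le {δ : ENNReal} {X Y : PMF α} (h : Close δ X Y) (k : α → ENNReal)
    (hk : ∀ a, k a ≤ 1) : ∑' a, X a * k a ≤ ∑' a, Y a * k a + δ := by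
  have h₁ : ∑' a, X a * k a ≤ ∑' a, Y a * k a + ∑' a, (X a - Y a) := by
    rw [← ENNReal.tsum_add]
    refine ENNReal.tsum_le_tsum fun a => ?_
    calc X a * k a ≤ (Y a + (X a - Y a)) * k a := by gcongr; exact le_add_tsub
      _ = Y a * k a + (X a - Y a) * k a := add_mul _ _ _
      _ ≤ Y a * k a + (X a - Y a) := by gcongr; exact mul_le_of_le_one_right' (hk a)
  refine h₁.trans ?_
  gcongr
  have h₂ := h {a | Y a < X a}
  have h₃ : X.toOuterMeasure {a | Y a < X a} =
      Y.toOuterMeasure {a | Y a < X a} + ∑' a, (X a - Y a) := by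
    rw [PMF.toOuterMeasure_apply, PMF.toOuterMeasure_apply, ← ENNReal.tsum_add]
    refine tsum_congr fun a => ?_
    by_cases ha : Y a < X a
    · simp [ha, add_tsub_cancel_of_le ha.le]
    · simp [ha, tsub_eq_zero_of_le (not_lt.1 ha)]
  rw [h₃] at h₂
  exact (ENNReal.add_le_add_iff_left (toOuterMeasure_ne_top _ _)).1 h₂

theorem tsum_map_mul (X : PMF γ) (π : γ → α) (k : α → ENNReal) :
    ∑' a, X.map π a * k a = ∑' c, X c * k (π c) := by
  classical
  simp only [PMF.map_apply, ← ENNReal.tsum_mul_right]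
  rw [ENNReal.tsum_comm]
  refine tsum_congr fun c => ?_
  simp only [ite_mul, zero_mul]
  exact tsum_ite_eq (π c) fun a => X c * k a

/-- The continuations are compared only over the support of the ideal `Y`, although `X` may leave
it. This is what allows function privacy, known for fresh ciphertexts, to be used on ciphertexts
that are merely close to fresh. The map `π` forgets the log. -/
theorem Close.bind {δ₁ δ₂ : ENNReal} {X : PMF γ} {π : γ → α} {Y : PMF α} {f : γ → PMF β}
    {g : α → PMF β} (h : Close δ₁ (X.map π) Y)
    (hfg : ∀ c, π c ∈ Y.support → Close δ₂ (f c) (g (π c))) :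
    Close (δ₁ + δ₂) (X.bind f) (Y.bind g) := by
  classical
  intro s
  rw [PMF.toOuterMeasure_bind_apply, PMF.toOuterMeasure_bind_apply]
  -- Off the support of `Y` the test takes its largest value 1: this costs nothing under `Y`, and
  -- under `X` it is already covered by `δ₁`.
  set k : α → ENNReal := fun a => if a ∈ Y.support then (g a).toOuterMeasure s else 1 with hk
  have h₁ : ∀ c, (f c).toOuterMeasure s ≤ k (π c) + δ₂ := by
    intro c
    simp only [hk]
    split_ifs with hc
    · exact hfg c hc s
    · exact (toOuterMeasure_le_one _ _).trans le_self_add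
  have h₂ := h.tsum_mul_le k (by
    intro a
    simp only [hk]
    split_ifs
    · exact toOuterMeasure_le_one _ _
    · exact le_rfl)
  rw [tsum_map_mul] at h₂
  have h₃ : ∑' a, Y a * k a = ∑' a, Y a * (g a).toOuterMeasure s := by
    refine tsum_congr fun a => ?_
    by_cases ha : a ∈ Y.support
    · simp only [hk, if_pos ha]
    · rw [PMF.mem_support_iff, not_not] at ha
      simp [ha]
  calc ∑' c, X c * (f c).toOuterMeasure s ≤ ∑' c, (X c * k (π c) + X c * δ₂) := by
        refine ENNReal.tsum_le_tsum fun c => ?_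
        rw [← mul_add]
        gcongr
        exact h₁ c
    _ = ∑' c, X c * k (π c) + δ₂ := by
        rw [ENNReal.tsum_add, ENNReal.tsum_mul_right, X.tsum_coe, one_mul]
    _ ≤ ∑' a, Y a * (g a).toOuterMeasure s + (δ₁ + δ₂) := by
        rw [← h₃, ← add_assoc]
        gcongr

theorem Close.bind_left {δ : ENNReal} (X : PMF γ) {f g : γ → PMF β}
    (h : ∀ c, Close δ (f c) (g c)) : Close δ (X.bind f) (X.bind g) := by
  have : Close 0 (X.map id) X := by rw [PMF.map_id]; exact .refl X
  simpa using this.bind fun c _ => h c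

end Close

/-! ### Independent samples -/

section Indep

variable {α β γ : Type}

/-- Independent samples of `f a` for the members `a` of a list. -/
def indep (f : α → PMF β) : List α → PMF (List β)
  | [] => PMF.pure []
  | a :: l => (f a).bind fun b => (indep f l).map (List.cons b)

theorem indep_append (f : α → PMF β) (l m : List α) :
    indep f (l ++ m) = (indep f l).bind fun x => (indep f m).map (x ++ ·) := by
  induction l with
  | nil =>
    simp only [List.nil_append, indep, PMF.pure_bind]
    exact (PMF.map_id _).symm
  | cons a l ih =>
    simp only [List.cons_append, indep, ih, PMF.map_bind, PMF.bind_bind, PMF.bind_map, PMF.map_comp]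
    rfl

theorem indep_map_list (f : α → PMF β) (g : γ → α) (l : List γ) :
    indep f (l.map g) = indep (fun c => f (g c)) l := by
  induction l with
  | nil => rfl
  | cons a l ih => simp [indep, ih]

theorem indep_map (f : α → PMF β) (g : β → γ) (l : List α) :
    indep (fun a => (f a).map g) l = (indep f l).map (List.map g) := by
  induction l with
  | nil => simp [indep, PMF.pure_map]
  | cons a l ih =>
    simp only [indep, ih, PMF.map_bind, PMF.bind_map, PMF.map_comp]
    rfl

theorem forall₂_of_mem_support_indep {f : α → PMF β} {l : List α} {x : List β}
    (hx : x ∈ (indep f l).support) : List.Forall₂ (fun a b => b ∈ (f a).support) l x := by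
  induction l generalizing x with
  | nil => simp [indep] at hx; simp [hx]
  | cons a l ih =>
    simp only [indep, PMF.mem_support_bind_iff, PMF.mem_support_map_iff] at hx
    obtain ⟨b, hb, y, hy, rfl⟩ := hx
    exact .cons hb (ih hy)

/-- A list of `n` independent samples of `X`. -/
def iid (X : PMF β) (n : ℕ) : PMF (List β) := indep (fun _ : Unit => X) (List.replicate n ())

theorem indep_const (X : PMF β) (l : List α) : indep (fun _ => X) l = iid X l.length := by
  induction l with
  | nil => rfl
  | cons a l ih => simp only [indep, ih, iid, List.length_cons, List.replicate_succ]

theorem iid_succ (X : PMF β) (n : ℕ) :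
    iid X (n + 1) = X.bind fun b => (iid X n).map (List.cons b) := rfl

theorem iid_add (X : PMF β) (m n : ℕ) :
    iid X (m + n) = (iid X m).bind fun x => (iid X n).map (x ++ ·) := by
  rw [iid, List.replicate_add, indep_append]
  rfl

theorem iid_map (X : PMF β) (g : β → γ) (n : ℕ) :
    iid (X.map g) n = (iid X n).map (List.map g) := indep_map _ _ _

theorem uniformOfFintype_map_equiv [Fintype α] [Nonempty α] [Fintype β] [Nonempty β] (e : α ≃ β) :
    (PMF.uniformOfFintype α).map e = PMF.uniformOfFintype β := by
  classical
  ext b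
  rw [PMF.map_apply, tsum_eq_single (e.symm b)]
  · simp [Fintype.card_congr e]
  · intro a ha
    rw [if_neg]
    rintro rfl
    simp at ha

theorem uniformOfFintype_prod [Fintype α] [Nonempty α] [Fintype β] [Nonempty β] :
    PMF.uniformOfFintype (α × β) =
      (PMF.uniformOfFintype α).bind fun a => (PMF.uniformOfFintype β).map (Prod.mk a) := by
  classical
  ext ⟨a, b⟩
  rw [PMF.bind_apply, tsum_eq_single a]
  · rw [PMF.map_apply, tsum_eq_single b]
    · simp [ENNReal.mul_inv]
    · intro b' hb'
      simp [hb'.symm]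
  · intro a' ha'
    simp [PMF.map_apply, ha'.symm]

theorem iid_uniform [Fintype α] [Nonempty α] (n : ℕ) :
    iid (PMF.uniformOfFintype α) n =
      (PMF.uniformOfFintype (Fin n → α)).map List.ofFn := by
  induction n with
  | zero =>
    have : (List.ofFn : (Fin 0 → α) → List α) = Function.const _ [] := by
      funext f; simp
    rw [this, PMF.map_const]
    rfl
  | succ n ih =>
    rw [iid_succ, ih, ← uniformOfFintype_map_equiv (Fin.consEquiv fun _ : Fin (n + 1) => α),
      uniformOfFintype_prod]
    simp only [PMF.map_bind, PMF.map_comp]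
    congr 1
    funext b
    congr 1
    funext f
    simp [Fin.consEquiv, List.ofFn_succ]

theorem mapD_list (B : Data → PMF Data) (e : Data) (l : List Data) :
    mapD B e (Data.list l) = (indep (fun a => B (.cons e a)) l).map Data.list := by
  induction l with
  | nil => simp [Data.list, mapD, indep, PMF.pure_map]
  | cons a l ih =>
    simp only [Data.list, mapD, indep, ih, PMF.map_bind, PMF.map_comp]
    rfl

theorem mapD_const {B : Data → PMF Data} {e : Data} {X : PMF Data}
    (h : ∀ a, B (.cons e a) = X) (l : Data) :
    mapD B e l = (iid X l.len).map Data.list := by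
  obtain ⟨l, rfl⟩ := l.exists_list
  simp only [mapD_list, h, indep_const, Data.len_list]

/-- A uniformly random string of as many bits as the list `c` is long. -/
def coinString (c : Data) : PMF Data := mapD (fun _ => coinFlip) .nil c

theorem ppt_coinString : PPT coinString := ppt_coinFlip.mapD PolyTime.nil PolyTime.id

theorem coinString_unary (c : ℕ) :
    coinString (Data.unary c) = (PMF.uniformOfFintype (Fin c → Bool)).map Data.bits := by
  rw [coinString, mapD_const (fun _ => rfl), Data.unary, Data.len_list, List.length_replicate,
    coinFlip, iid_map, iid_uniform, PMF.map_comp, PMF.map_comp]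
  congr 1
  funext r
  simp [Data.bits, Function.comp_def]

end Indep

/-! ### The server's computation -/

theorem bind_congr_support {α β : Type} {X : PMF α} {f g : α → PMF β}
    (h : ∀ a ∈ X.support, f a = g a) : X.bind f = X.bind g := by
  ext b
  simp only [PMF.bind_apply]
  refine tsum_congr fun a => ?_
  by_cases ha : a ∈ X.support
  · rw [h a ha]
  · rw [PMF.mem_support_iff, not_not] at ha
    simp [ha]

theorem Logged.run_bind {α β : Type} (X : Logged α) (f : α → Logged β) (log : List Data) :
    (X >>= f).run log = (X.run log).bind fun p => (f p.1).run p.2 := rfl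

theorem Logged.run_pure {α : Type} (a : α) (log : List Data) :
    (pure a : Logged α).run log = PMF.pure (a, log) := rfl

section Server

variable {R : ℕ → Type} [∀ n, CommRing (R n)] {S : HEScheme R} {n : ℕ} {α β ι κ : Type}

/-! ### Closeness of logged computations to ideal distributions -/

/-- The result of the computation is statistically close to `Y`, whatever was logged before. -/
def LClose (δ : ENNReal) (X : Logged α) (Y : PMF α) : Prop :=
  ∀ log, Close δ ((X.run log).map Prod.fst) Y

theorem LClose.mono {δ δ' : ENNReal} {X : Logged α} {Y : PMF α} (h : LClose δ X Y) (hδ : δ ≤ δ') :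
    LClose δ' X Y := fun log => (h log).mono hδ

theorem LClose.pure (a : α) : LClose 0 (pure a) (PMF.pure a) := fun log => by
  rw [Logged.run_pure, PMF.pure_map]
  exact .refl _

theorem LClose.bind {δ₁ δ₂ : ENNReal} {X : Logged α} {Y : PMF α} {f : α → Logged β}
    {g : α → PMF β} (h : LClose δ₁ X Y) (hfg : ∀ a ∈ Y.support, LClose δ₂ (f a) (g a)) :
    LClose (δ₁ + δ₂) (X >>= f) (Y.bind g) := by
  intro log
  rw [Logged.run_bind, PMF.map_bind]
  exact (h log).bind fun c hc => hfg _ hc _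

/-- The form in which operations are chained: if every ideal operand leads close to the same `Z`,
the operand's randomness is forgotten. -/
theorem LClose.bind_const {δ₁ δ₂ : ENNReal} {X : Logged α} {Y : PMF α} {f : α → Logged β}
    {Z : PMF β} (h : LClose δ₁ X Y) (hfg : ∀ a ∈ Y.support, LClose δ₂ (f a) Z) :
    LClose (δ₁ + δ₂) (X >>= f) Z := by
  simpa using h.bind hfg

theorem LClose.mapM {δ : ENNReal} {F : ι → Logged α} {G : κ → PMF α} {l : List ι} {m : List κ}
    (h : List.Forall₂ (fun i j => LClose δ (F i) (G j)) l m) :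
    LClose (m.length * δ) (l.mapM F) (indep G m) := by
  induction h with
  | nil => simpa [indep] using LClose.pure ([] : List α)
  | @cons i j l m h _ ih =>
    rw [List.mapM_cons]
    refine LClose.mono (h.bind (δ₂ := m.length * δ + 0) fun b _ => ?_) ?_
    · rw [← PMF.bind_pure_comp]
      exact ih.bind fun x _ => LClose.pure _
    · simp [add_mul, add_comm]

/-- Invariant: the accumulator is close to a fresh sample of `E` at the current value. Each step
restores the invariant at the cost of one further `δ`. -/
theorem LClose.foldlM {δ δ₀ : ENNReal} {E : β → PMF α} {step : α → ι → Logged α}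
    {val : β → κ → β} {l : List ι} {m : List κ}
    (h : List.Forall₂ (fun i j => ∀ v, ∀ a ∈ (E v).support, LClose δ (step a i) (E (val v j))) l m)
    {X : Logged α} {v : β} (hX : LClose δ₀ X (E v)) :
    LClose (δ₀ + m.length * δ) (X >>= fun a => l.foldlM step a) (E (m.foldl val v)) := by
  induction h generalizing X v δ₀ with
  | nil => simpa using hX
  | @cons i j l m h _ ih =>
    simp only [List.foldlM_cons, List.foldl_cons]
    rw [← bind_assoc]
    refine (ih (hX.bind_const fun a ha => h v a ha)).mono ?_
    simp [add_mul, add_comm, add_left_comm, add_assoc]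

/-! ### Coin tosses of logged computations -/

/-- The computation makes exactly `t` tosses of `S`, and its result satisfies `Q`. -/
def Tosses (S : HEScheme R) (n : ℕ) (X : Logged α) (t : ℕ) (Q : α → Prop) : Prop :=
  ∀ log, (X.run log).map Prod.snd = (iid ((S.toss n).map Data.bits) t).map (log ++ ·) ∧
    ∀ p ∈ (X.run log).support, Q p.1

theorem Tosses.pure {a : α} {Q : α → Prop} (h : Q a) : Tosses S n (pure a) 0 Q := by
  intro log
  rw [Logged.run_pure, PMF.pure_map]
  refine ⟨by simp [iid, indep, PMF.pure_map], ?_⟩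
  rintro p hp
  simp at hp
  simpa [hp]

/-- The later number of tosses may depend on the intermediate result only through what `P` fixes. In
the application `P` records the length of a list of ciphertexts, so the log carries no trace of the
ciphertexts themselves. -/
theorem Tosses.bind {X : Logged α} {f : α → Logged β} {s t : ℕ} {P : α → Prop} {Q : β → Prop}
    (h : Tosses S n X s P) (hf : ∀ a, P a → Tosses S n (f a) t Q) :
    Tosses S n (X >>= f) (s + t) Q := by
  intro log
  rw [Logged.run_bind]
  constructor
  · rw [PMF.map_bind, bind_congr_support fun p hp => (hf p.1 ((h log).2 p hp) p.2).1]
    have := PMF.bind_map (X.run log) Prod.snd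
      fun x => (iid ((S.toss n).map Data.bits) t).map (x ++ ·)
    simp only [Function.comp_def] at this
    rw [← this, (h log).1, iid_add, PMF.map_bind, PMF.bind_map]
    congr 1
    funext x
    simp [PMF.map_comp, Function.comp_def]
  · intro p hp
    rw [PMF.mem_support_bind_iff] at hp
    obtain ⟨q, hq, hp⟩ := hp
    exact (hf _ ((h log).2 q hq) _).2 p hp

theorem Tosses.mapM {F : ι → Logged α} {t : ℕ} (h : ∀ i, Tosses S n (F i) t fun _ => True)
    (l : List ι) : Tosses S n (l.mapM F) (l.length * t) fun x => x.length = l.length := by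
  induction l with
  | nil => simpa using Tosses.pure (S := S) (n := n) (a := ([] : List α)) (Q := fun x => x.length = 0) rfl
  | cons i l ih =>
    rw [List.mapM_cons]
    have := (h i).bind fun b _ => ih.bind (t := 0) (Q := fun x => x.length = l.length + 1)
      fun x hx => Tosses.pure (a := b :: x) (by simp [hx])
    rw [List.length_cons, add_mul, one_mul, add_comm]
    exact this

theorem Tosses.foldlM {step : α → ι → Logged α} {t : ℕ}
    (h : ∀ a i, Tosses S n (step a i) t fun _ => True) (l : List ι) (a : α) :
    Tosses S n (l.foldlM step a) (l.length * t) fun _ => True := by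
  induction l generalizing a with
  | nil => simpa using Tosses.pure (S := S) (n := n) (a := a) trivial
  | cons i l ih =>
    rw [List.foldlM_cons]
    have := (h a i).bind fun b _ => ih b
    convert this using 1
    simp [add_mul, add_comm]

theorem run_loggedToss_bind (g : S.Coin n → α) (log : List Data) :
    (loggedToss S n >>= fun r => (pure (g r) : Logged α)).run log =
      (S.toss n).map fun r => (g r, log ++ [Data.bits r]) := by
  rw [Logged.run_bind]
  simp only [loggedToss, StateT.run, PMF.bind_map, Function.comp_def]
  exact PMF.bind_pure_comp _ _

theorem lClose_loggedToss (g : S.Coin n → α) :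
    LClose 0 (loggedToss S n >>= fun r => (pure (g r) : Logged α)) ((S.toss n).map g) := by
  intro log
  rw [run_loggedToss_bind, PMF.map_comp]
  exact .refl _

theorem tosses_loggedToss (g : S.Coin n → α) :
    Tosses S n (loggedToss S n >>= fun r => (pure (g r) : Logged α)) 1 fun _ => True := by
  intro log
  rw [run_loggedToss_bind, PMF.map_comp]
  refine ⟨?_, fun _ _ => trivial⟩
  rw [iid_succ, PMF.map_bind, PMF.bind_map]
  simp only [iid, indep, List.replicate_zero, PMF.pure_map]
  exact (PMF.bind_pure_comp _ _).symm

/-- Fresh encryption. -/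
def encD (S : HEScheme R) (n : ℕ) (pk : Data) (m : R n) : PMF Data :=
  (S.toss n).map (S.encrypt n pk m)

/-- The operations on ciphertexts under `pk` have statistical error at most `ε`. -/
def OpsClose (S : HEScheme R) (n : ℕ) (pk : Data) (ε : ENNReal) : Prop :=
  ∀ (m₁ m₂ : R n) (c₁ c₂ : Data), c₁ ∈ (encD S n pk m₁).support → c₂ ∈ (encD S n pk m₂).support →
    LClose ε (addL S n pk c₁ c₂) (encD S n pk (m₁ + m₂)) ∧
    LClose ε (mulL S n pk c₁ c₂) (encD S n pk (m₁ * m₂))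

theorem lClose_encL (pk : Data) (m : R n) : LClose 0 (encL S n pk m) (encD S n pk m) :=
  lClose_loggedToss _

theorem opsClose_of_statClose {ε : ℝ} {rK : S.Coin n}
    (h : ∀ (m₁ m₂ : R n) (r₁ r₂ : S.Coin n),
      StatClose ε
        ((S.toss n).map (S.addC n (S.pk n rK)
          (S.encrypt n (S.pk n rK) m₁ r₁) (S.encrypt n (S.pk n rK) m₂ r₂)))
        ((S.toss n).map (S.encrypt n (S.pk n rK) (m₁ + m₂))) ∧
      StatClose ε
        ((S.toss n).map (S.mulC n (S.pk n rK)
          (S.encrypt n (S.pk n rK) m₁ r₁) (S.encrypt n (S.pk n rK) m₂ r₂)))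
        ((S.toss n).map (S.encrypt n (S.pk n rK) (m₁ * m₂)))) :
    OpsClose S n (S.pk n rK) (ENNReal.ofReal ε) := by
  intro m₁ m₂ c₁ c₂ h₁ h₂
  rw [encD, PMF.mem_support_map_iff] at h₁ h₂
  obtain ⟨r₁, -, rfl⟩ := h₁
  obtain ⟨r₂, -, rfl⟩ := h₂
  constructor
  · intro log
    rw [addL, run_loggedToss_bind, PMF.map_comp]
    exact (h m₁ m₂ r₁ r₂).1.close
  · intro log
    rw [mulL, run_loggedToss_bind, PMF.map_comp]
    exact (h m₁ m₂ r₁ r₂).2.close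

variable {pk : Data} {ε : ENNReal}

/-- `c` is a list of ciphertexts of the entries of `x`. -/
def Encrypts (S : HEScheme R) (n : ℕ) (pk : Data) (x : List (R n)) (c : List Data) : Prop :=
  List.Forall₂ (fun m c => c ∈ (encD S n pk m).support) x c

/-- Each weight needs one multiplication and one addition, hence `2 * ε`; encrypting the weight and
the bias is exact. -/
theorem OpsClose.rowF (h : OpsClose S n pk ε) (w : List (R n)) (b : R n) {x : List (R n)}
    {c : List Data} (hc : Encrypts S n pk x c) :
    LClose ((w.zip x).length * (2 * ε)) (rowF S n pk w b c)
      (encD S n pk ((w.zip x).foldl (fun v p => v + p.1 * p.2) b)) := by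
  have hz : List.Forall₂ (fun (i : R n × Data) (j : R n × R n) =>
      ∀ v, ∀ a ∈ (encD S n pk v).support,
        LClose (2 * ε) (do
          let e ← encL S n pk i.1
          let t ← mulL S n pk e i.2
          addL S n pk a t) (encD S n pk (v + j.1 * j.2))) (w.zip c) (w.zip x) := by
    induction hc generalizing w with
    | nil => simp
    | @cons m c x cs hm _ ih =>
      cases w with
      | nil => simp
      | cons u w =>
        simp only [List.zip_cons_cons]
        refine .cons (fun v a ha => ?_) (ih w)
        refine LClose.mono ((lClose_encL pk u).bind_const fun e he =>
          ((h u m e c he hm).2.bind_const fun t ht => (h v _ a t ha ht).1)) ?_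
        rw [zero_add, two_mul]
  have := LClose.foldlM hz (lClose_encL pk b)
  rwa [zero_add] at this

theorem foldl_zip_ofFn {A : Type} [CommRing A] {k : ℕ} (w x : Fin k → A) (b : A) :
    ((List.ofFn w).zip (List.ofFn x)).foldl (fun v p => v + p.1 * p.2) b
      = ∑ j, w j * x j + b := by
  induction k generalizing b with
  | zero => simp
  | succ k ih =>
    simp only [List.ofFn_succ, List.zip_cons_cons, List.foldl_cons, ih, Fin.sum_univ_succ]
    ring

theorem OpsClose.matF (h : OpsClose S n pk ε) {k m : ℕ} (W : Matrix (Fin m) (Fin k) (R n))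
    (b : Fin m → R n) {x : Fin k → R n} {c : List Data}
    (hc : Encrypts S n pk (List.ofFn x) c) :
    LClose (m * (k * (2 * ε))) (matF S n pk W b c)
      (indep (encD S n pk) (List.ofFn (W.mulVec x + b))) := by
  have : List.Forall₂ (fun i j => LClose (k * (2 * ε)) (Proud.rowF S n pk (List.ofFn (W i)) (b i) c)
      (encD S n pk ((W.mulVec x + b) j))) (List.finRange m) (List.finRange m) := by
    rw [List.forall₂_same]
    intro i _
    have := h.rowF (List.ofFn (W i)) (b i) hc
    rw [foldl_zip_ofFn, List.length_zip, List.length_ofFn, List.length_ofFn, min_self] at this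
    exact this
  have := LClose.mapM this
  rw [List.length_finRange, ← indep_map_list (encD S n pk)] at this
  rwa [List.ofFn_eq_map]

theorem foldl_horner {A : Type} [CommRing A] {D : ℕ} (a : Fin D → A) (z : A) :
    (List.ofFn a).reverse.foldl (fun v u => u + v * z) 0 = ∑ j, a j * z ^ (j : ℕ) := by
  rw [List.foldl_reverse]
  induction D with
  | zero => simp
  | succ D ih =>
    rw [List.ofFn_succ, List.foldr_cons, ih, Fin.sum_univ_succ, Finset.sum_mul]
    simp [pow_succ, mul_assoc]

theorem OpsClose.hornerF (h : OpsClose S n pk ε) {D : ℕ} (a : Fin D → R n) {z : R n} {c : Data}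
    (hc : c ∈ (encD S n pk z).support) :
    LClose (D * (2 * ε)) (hornerF S n pk (List.ofFn a) c)
      (encD S n pk (∑ j, a j * z ^ (j : ℕ))) := by
  have hz : List.Forall₂ (fun i j => ∀ v, ∀ acc ∈ (encD S n pk v).support,
      LClose (2 * ε) (do
        let t ← mulL S n pk acc c
        let e ← encL S n pk i
        addL S n pk e t) (encD S n pk (j + v * z)))
      (List.ofFn a).reverse (List.ofFn a).reverse := by
    rw [List.forall₂_same]
    intro u _ v acc hacc
    refine LClose.mono ((h v z acc c hacc hc).2.bind_const fun t ht =>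
      ((lClose_encL pk u).bind_const fun e he => (h u _ e t he ht).1)) ?_
    rw [zero_add, two_mul]
  have := LClose.foldlM hz (lClose_encL pk 0)
  rw [foldl_horner, zero_add, List.length_reverse, List.length_ofFn] at this
  exact this

theorem OpsClose.polyF (h : OpsClose S n pk ε) {D l : ℕ} (a : Fin D → R n) {z : Fin l → R n}
    {c : List Data} (hc : Encrypts S n pk (List.ofFn z) c) :
    LClose (l * (D * (2 * ε))) (polyF S n pk (List.ofFn a) c)
      (indep (encD S n pk) (List.ofFn fun i => ∑ j, a j * z i ^ (j : ℕ))) := by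
  have : List.Forall₂ (fun c y => LClose (D * (2 * ε)) (Proud.hornerF S n pk (List.ofFn a) c)
      (encD S n pk (∑ j, a j * y ^ (j : ℕ)))) c (List.ofFn z) :=
    (hc.imp fun y c hy => h.hornerF a hy).flip
  have := LClose.mapM this
  rw [List.length_ofFn, ← indep_map_list (encD S n pk) fun y => ∑ j, a j * y ^ (j : ℕ),
    List.map_ofFn] at this
  exact this

/-- Number of coin strings that the server tosses. -/
def Net.tosses {A : Type} : {k m : ℕ} → Net A k m → ℕ
  | k, m, .last _ _ => m * (1 + 3 * k)
  | k, _, .hidden (l := l) (D := D) _ _ _ rest => l * (1 + 3 * k) + (l * (1 + 3 * D) + rest.tosses)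

/-- The ideal output of a layer is a list of fresh ciphertexts, which is exactly what the next layer
assumes of its input. -/
theorem OpsClose.serverF (h : OpsClose S n pk ε) {k m : ℕ} (N : Net (R n) k m) {x : Fin k → R n}
    {c : List Data} (hc : Encrypts S n pk (List.ofFn x) c) :
    LClose (N.tosses * ε) (serverF S n pk N c) (indep (encD S n pk) (List.ofFn (N.eval x))) := by
  -- Two operations per weight or coefficient are majorized by the tosses made for it, so that one
  -- count, `Net.tosses`, serves both for the error and for the log.
  have arith : ∀ a b : ℕ, (a * (b * (2 * ε)) : ENNReal) ≤ (a * (1 + 3 * b) : ℕ) * ε := by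
    intro a b
    rw [← mul_assoc, ← mul_assoc]
    gcongr
    norm_cast
    nlinarith [Nat.zero_le (a * b)]
  induction N generalizing c with
  | last W b => exact (h.matF W b hc).mono (arith _ _)
  | @hidden k l m D W b a rest ih =>
    refine LClose.mono ((h.matF W b hc).bind_const fun z hz => (h.polyF a (z := W.mulVec x + b)
      (forall₂_of_mem_support_indep hz)).bind_const fun y hy =>
        ih (forall₂_of_mem_support_indep hy)) ?_
    simp only [Net.tosses, Nat.cast_add, add_mul]
    exact add_le_add (arith _ _) (add_le_add (arith _ _) le_rfl)

theorem tosses_rowF (w : List (R n)) (b : R n) (c : List Data) :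
    Tosses S n (rowF S n pk w b c) (1 + (w.zip c).length * 3) fun _ => True :=
  (tosses_loggedToss _).bind fun _ _ => Tosses.foldlM (fun _ _ =>
    (tosses_loggedToss _).bind (t := 2) fun _ _ => (tosses_loggedToss _).bind fun _ _ =>
      tosses_loggedToss _) _ _

theorem tosses_hornerF (a : List (R n)) (c : Data) :
    Tosses S n (hornerF S n pk a c) (1 + a.length * 3) fun _ => True := by
  have := (tosses_loggedToss (S := S) (S.encrypt n pk 0)).bind (fun start _ =>
    Tosses.foldlM (step := fun acc aj => do
      let t ← mulL S n pk acc c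
      let e ← encL S n pk aj
      addL S n pk e t) (fun _ _ =>
    (tosses_loggedToss _).bind (t := 2) fun _ _ => (tosses_loggedToss _).bind fun _ _ =>
      tosses_loggedToss _) a.reverse start)
  rwa [List.length_reverse] at this

theorem tosses_matF {k m : ℕ} (W : Matrix (Fin m) (Fin k) (R n)) (b : Fin m → R n)
    {c : List Data} (hc : c.length = k) :
    Tosses S n (matF S n pk W b c) (m * (1 + 3 * k)) fun x => x.length = m := by
  have := Tosses.mapM (S := S) (n := n) (t := 1 + 3 * k)
    (F := fun i => rowF S n pk (List.ofFn (W i)) (b i) c) (fun i => by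
      have := tosses_rowF (S := S) (pk := pk) (List.ofFn (W i)) (b i) c
      simpa [hc, mul_comm] using this) (List.finRange m)
  rwa [List.length_finRange] at this

theorem tosses_serverF {k m : ℕ} (N : Net (R n) k m) {c : List Data} (hc : c.length = k) :
    Tosses S n (serverF S n pk N c) N.tosses fun _ => True := by
  induction N generalizing c with
  | last W b =>
    exact fun log => ⟨(tosses_matF W b hc log).1, fun _ _ => trivial⟩
  | hidden W b a rest ih =>
    refine (tosses_matF W b hc).bind fun z hz => ?_
    have := Tosses.mapM (fun c => tosses_hornerF (S := S) (pk := pk) (List.ofFn a) c) z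
    rw [hz, List.length_ofFn, mul_comm _ 3] at this
    exact this.bind fun y hy => ih hy

end Server

/-! ### Counting the server's coin tosses -/

/-- One step of `rowTosses`. -/
def rowTossesStep (d : Data) : Data :=
  .cons .nil (d.tl.hd.hd.tl.revAppend (d.tl.hd.hd.tl.revAppend (d.tl.hd.hd.tl.revAppend
    (d.hd.revAppend d.tl.tl))))

/-- A list with `1 + 3 k + |e|` more members than `s` for each row of `k` weights. -/
def rowTosses (e rows s : Data) : Data := Data.foldWith rowTossesStep e rows s

theorem polyTime_rowTossesStep : PolyTime rowTossesStep :=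
  have w : PolyTime fun d => d.tl.hd.hd.tl := PolyTime.id.tl.hd.hd.tl
  PolyTime.nil.cons (w.revAppend (w.revAppend (w.revAppend
    (PolyTime.id.hd.revAppend PolyTime.id.tl.tl))))

theorem size_rowTossesStep_le (e l s : Data) : (rowTossesStep (.cons e (.cons l s))).size ≤
    s.size + (3 * Polynomial.X + 2 : Polynomial ℕ).eval (e.size + l.size) := by
  have h₀ := l.size_hd_le
  have h₁ := l.hd.size_tl_le
  have h₂ := e.size_revAppend_le s
  have h₃ := l.hd.tl.size_revAppend_le (e.revAppend s)
  have h₄ := l.hd.tl.size_revAppend_le (l.hd.tl.revAppend (e.revAppend s))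
  have h₅ := l.hd.tl.size_revAppend_le (l.hd.tl.revAppend (l.hd.tl.revAppend (e.revAppend s)))
  simp only [rowTossesStep, Data.hd_cons, Data.tl_cons, Data.size, Polynomial.eval_add,
    Polynomial.eval_mul, Polynomial.eval_X, Polynomial.eval_ofNat]
  omega

theorem len_rowTosses {k : ℕ} (e s : Data) (rows : List Data) (h : ∀ a ∈ rows, a.tl.len = k) :
    (rowTosses e (Data.list rows) s).len = rows.length * (1 + 3 * k + e.len) + s.len := by
  induction rows generalizing s with
  | nil => simp [rowTosses, Data.list, Data.foldWith]
  | cons a rows ih =>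
    have := ih (rowTossesStep (.cons e (.cons (.cons a (Data.list rows)) s)))
      fun b hb => h b (List.mem_cons_of_mem _ hb)
    rw [rowTosses] at this
    rw [rowTosses, Data.list, Data.foldWith, this]
    simp only [rowTossesStep, Data.len, Data.len_revAppend, Data.hd_cons, Data.tl_cons,
      h a List.mem_cons_self, List.length_cons]
    ring

/-- One step of `netTosses`. -/
def netTossesStep (d : Data) : Data :=
  -- A nonempty remaining suffix marks a hidden layer, whose code is a pair of the affine part and
  -- the coefficients. Each of its rows is charged for its Horner evaluation too, by the list of
  -- length `1 + 3 D`; the last layer is an affine part alone.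
  let a := d.tl.hd.hd.tl
  rowTosses
    (Data.select d.tl.hd.tl (.cons .nil (a.revAppend (a.revAppend (a.revAppend .nil)))) .nil)
    (Data.select d.tl.hd.tl d.tl.hd.hd.hd d.tl.hd.hd) d.tl.tl

/-- A list with one member for each toss that the server makes, from the code of its network. -/
def netTosses (d : Data) : Data := Data.foldWith netTossesStep .nil d .nil

theorem Data.size_select_le (c a b : Data) : (select c a b).size ≤ max a.size b.size := by
  cases c <;> simp [select]

theorem polyTime_netTosses : PolyTime netTosses := by
  have h : PolyTime netTossesStep :=
    have a : PolyTime fun d => d.tl.hd.hd.tl := PolyTime.id.tl.hd.hd.tl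
    have r : PolyTime fun d => d.tl.hd.tl := PolyTime.id.tl.hd.tl
    polyTime_rowTossesStep.foldWith _ size_rowTossesStep_le
      (r.select (PolyTime.nil.cons (a.revAppend (a.revAppend (a.revAppend PolyTime.nil))))
        PolyTime.nil)
      (r.select PolyTime.id.tl.hd.hd.hd PolyTime.id.tl.hd.hd) PolyTime.id.tl.tl
  -- With suffix size X, the extra list has size at most 3X + 3 and the rows at most X, which gives
  -- the argument 4X + 3. The factor X bounds the rounds of the inner loop.
  refine h.foldWith (Polynomial.X *
    (3 * Polynomial.X + 2 : Polynomial ℕ).comp (4 * Polynomial.X + 3)) (fun e l s => ?_)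
    PolyTime.nil PolyTime.id PolyTime.nil
  simp only [netTossesStep, Data.hd_cons, Data.tl_cons]
  set a := l.hd.tl
  set x := Data.select l.tl (.cons .nil (a.revAppend (a.revAppend (a.revAppend .nil)))) .nil with hx
  set y := Data.select l.tl l.hd.hd l.hd with hy
  have h₀ := l.size_hd_le
  have h₁ : a.size ≤ l.size := l.hd.size_tl_le.trans h₀
  have h₂ := a.size_revAppend_le .nil
  have h₃ := a.size_revAppend_le (a.revAppend .nil)
  have h₄ := a.size_revAppend_le (a.revAppend (a.revAppend .nil))
  have h₅ : y.size ≤ l.size := by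
    have := Data.size_select_le l.tl l.hd.hd l.hd
    rw [← hy] at this
    have := l.hd.size_hd_le
    omega
  have h₆ : x.size ≤ 3 * l.size + 3 := by
    have := Data.size_select_le l.tl
      (.cons .nil (a.revAppend (a.revAppend (a.revAppend .nil)))) .nil
    rw [← hx] at this
    simp only [Data.size] at *
    omega
  have h₇ := Data.size_foldWith_le size_rowTossesStep_le x y s
  refine h₇.trans ?_
  rw [Polynomial.eval_mul, Polynomial.eval_X, Polynomial.eval_comp]
  gcongr
  · omega
  · refine eval_mono _ ?_
    simp only [Polynomial.eval_add, Polynomial.eval_mul, Polynomial.eval_X, Polynomial.eval_ofNat]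
    omega

theorem len_affineCode {A : Type} (code : A → Data) {k m : ℕ} (W : Matrix (Fin m) (Fin k) A)
    (b : Fin m → A) (e s : Data) :
    (rowTosses e (affineCode code W b) s).len = m * (1 + 3 * k + e.len) + s.len := by
  rw [affineCode, len_rowTosses (k := k), List.length_ofFn]
  intro a ha
  rw [List.mem_ofFn] at ha
  obtain ⟨i, rfl⟩ := ha
  simp [Data.len_list]

theorem Net.code_eq_cons {A : Type} (code : A → Data) {k m : ℕ} (N : Net A k m) :
    ∃ a r, N.code code = Data.cons a r := by
  cases N with
  | last W b => exact ⟨_, _, rfl⟩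
  | hidden W b a rest => exact ⟨_, _, rfl⟩

theorem len_netTosses {A : Type} (code : A → Data) {k m : ℕ} (N : Net A k m) :
    (netTosses (N.code code)).len = N.tosses := by
  suffices ∀ s, (Data.foldWith netTossesStep .nil (N.code code) s).len = N.tosses + s.len from
    this .nil
  induction N with
  | last W b =>
    intro s
    simp [Net.code, Data.list, Data.foldWith, netTossesStep, Data.select, len_affineCode,
      Net.tosses, Data.len]
  | hidden W b a rest ih =>
    intro s
    -- The remaining layers have a nonempty code, so the test in `netTossesStep` takes the branch
    -- for hidden layers.
    obtain ⟨x, y, hxy⟩ := rest.code_eq_cons code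
    simp only [Net.code, Data.foldWith, ih, Net.tosses]
    simp only [netTossesStep, Data.hd_cons, Data.tl_cons, hxy, Data.select, len_affineCode,
      Data.len, Data.len_revAppend, Data.len_list, List.length_ofFn]
    ring

/-! ### The simulators -/

section Simulators

variable {R : ℕ → Type} [∀ n, CommRing (R n)] (S : HEScheme R)

/-- Input `((1ⁿ, pk), m)`, output a fresh encryption of `m`; `fc` computes the number of coins. -/
def sampleEnc (fc : Data → Data) (d : Data) : PMF Data :=
  (coinString (fc d.hd.hd)).map fun r => S.enc (Data.list [d.hd.hd, d.hd.tl, d.tl, r])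

/-- Input `(1ⁿ, _)`, output a coin string. -/
def sampleCoins (fc : Data → Data) (d : Data) : PMF Data := coinString (fc d.hd)

/-- The simulator of the server's view. -/
def serverSim (fc fz : Data → Data) (d : Data) : PMF Data :=
  (coinString (fc d.hd)).bind fun rK =>
    (mapD (sampleEnc S fc) (.cons d.hd (S.keyGen (Data.list [d.hd, rK])).hd)
      (Data.mapWith (fun x => fz x.hd) d.hd d.tl.hd)).bind fun cs =>
    (mapD (sampleCoins fc) d.hd (netTosses d.tl.tl.tl.hd)).map fun log =>
      Data.list [d, log, Data.list [(S.keyGen (Data.list [d.hd, rK])).hd, cs]]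

/-- The simulator of the client's view. -/
def clientSim (fc : Data → Data) (d : Data) : PMF Data :=
  (coinString (fc d.hd.hd)).bind fun rK =>
    (mapD (sampleCoins fc) d.hd.hd d.hd.tl.hd).bind fun rE =>
    (mapD (sampleEnc S fc) (.cons d.hd.hd (S.keyGen (Data.list [d.hd.hd, rK])).hd) d.tl.hd).map
      fun c => Data.list [d.hd, Data.list [rK, rE], c]

variable {S} {fc fz : Data → Data}

theorem ppt_sampleEnc (hfc : PolyTime fc) : PPT (sampleEnc S fc) :=
  PPT.map_input (f := fun x => S.enc (Data.list [x.hd.hd.hd, x.hd.hd.tl, x.hd.tl, x.tl]))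
    (ppt_coinString.comp (hfc.comp PolyTime.id.hd.hd))
    (S.enc_polyTime.comp (.list_cons PolyTime.id.hd.hd.hd (.list_cons PolyTime.id.hd.hd.tl
      (.list_cons PolyTime.id.hd.tl (.list_cons PolyTime.id.tl .list_nil)))))

theorem ppt_sampleCoins (hfc : PolyTime fc) : PPT (sampleCoins fc) :=
  ppt_coinString.comp (hfc.comp PolyTime.id.hd)

theorem ppt_serverSim (hfc : PolyTime fc) (hfz : PolyTime fz) : PPT (serverSim S fc fz) := by
  have pk : ∀ {u r : Data → Data}, PolyTime u → PolyTime r →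
      PolyTime fun x => (S.keyGen (Data.list [u x, r x])).hd := fun hu hr =>
    (S.keyGen_polyTime.comp (.list_cons hu (.list_cons hr .list_nil))).hd
  -- Here `y` is the environment `((d, rK), cs)`, and below `z` is `(y, log)`.
  have h₃ : PPT fun y => (mapD (sampleCoins fc) y.hd.hd.hd (netTosses y.hd.hd.tl.tl.tl.hd)).map
      fun log => Data.list [y.hd.hd, log,
        Data.list [(S.keyGen (Data.list [y.hd.hd.hd, y.hd.tl])).hd, y.tl]] :=
    PPT.map_input
      (f := fun z => Data.list [z.hd.hd.hd, z.tl,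
        Data.list [(S.keyGen (Data.list [z.hd.hd.hd.hd, z.hd.hd.tl])).hd, z.hd.tl]])
      ((ppt_sampleCoins hfc).mapD PolyTime.id.hd.hd.hd
        (polyTime_netTosses.comp PolyTime.id.hd.hd.tl.tl.tl.hd))
      (.list_cons PolyTime.id.hd.hd.hd (.list_cons PolyTime.id.tl (.list_cons
        (.list_cons (pk PolyTime.id.hd.hd.hd.hd PolyTime.id.hd.hd.tl)
          (.list_cons PolyTime.id.hd.tl .list_nil)) .list_nil)))
  have h₂ := PPT.bind_input ((ppt_sampleEnc (S := S) hfc).mapD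
    (PolyTime.id.hd.hd.cons (pk PolyTime.id.hd.hd PolyTime.id.tl))
    (PolyTime.mapWith (hfz.comp PolyTime.id.hd) PolyTime.id.hd.hd PolyTime.id.hd.tl.hd)) h₃
  exact PPT.bind_input (ppt_coinString.comp (hfc.comp PolyTime.id.hd)) h₂

theorem ppt_clientSim (hfc : PolyTime fc) : PPT (clientSim S fc) := by
  -- Here `y` is the environment `((d, rK), rE)`, and below `z` is `(y, c)`.
  have h₃ : PPT fun y => (mapD (sampleEnc S fc)
      (.cons y.hd.hd.hd.hd (S.keyGen (Data.list [y.hd.hd.hd.hd, y.hd.tl])).hd) y.hd.hd.tl.hd).map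
      fun c => Data.list [y.hd.hd.hd, Data.list [y.hd.tl, y.tl], c] :=
    PPT.map_input
      (f := fun z => Data.list [z.hd.hd.hd.hd, Data.list [z.hd.hd.tl, z.hd.tl], z.tl])
      ((ppt_sampleEnc hfc).mapD
        (PolyTime.id.hd.hd.hd.hd.cons (S.keyGen_polyTime.comp
          (.list_cons PolyTime.id.hd.hd.hd.hd (.list_cons PolyTime.id.hd.tl .list_nil))).hd)
        PolyTime.id.hd.hd.tl.hd)
      (.list_cons PolyTime.id.hd.hd.hd.hd (.list_cons (.list_cons PolyTime.id.hd.hd.tl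
        (.list_cons PolyTime.id.hd.tl .list_nil)) (.list_cons PolyTime.id.tl .list_nil)))
  have h₂ := PPT.bind_input ((ppt_sampleCoins hfc).mapD PolyTime.id.hd.hd.hd
    PolyTime.id.hd.hd.tl.hd) h₃
  exact PPT.bind_input (ppt_coinString.comp (hfc.comp PolyTime.id.hd.hd)) h₂

/-! ### Output distributions of the simulators -/

variable {n : ℕ}

theorem coinString_toss (h : fc (Data.unary n) = Data.unary (S.coins n)) :
    coinString (fc (Data.unary n)) = (S.toss n).map Data.bits := by
  rw [h, coinString_unary]
  rfl

theorem sampleEnc_eq (h : fc (Data.unary n) = Data.unary (S.coins n)) (pk : Data) (m : R n) :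
    sampleEnc S fc (.cons (.cons (Data.unary n) pk) (S.code n m)) = encD S n pk m := by
  simp only [sampleEnc, Data.hd_cons, Data.tl_cons]
  rw [coinString_toss h, PMF.map_comp]
  rfl

theorem mapD_sampleEnc (h : fc (Data.unary n) = Data.unary (S.coins n)) (pk : Data)
    (y : List (R n)) :
    mapD (sampleEnc S fc) (.cons (Data.unary n) pk) (Data.list (y.map (S.code n))) =
      (indep (encD S n pk) y).map Data.list := by
  simp only [mapD_list, indep_map_list, sampleEnc_eq h]

theorem mapD_sampleCoins (h : fc (Data.unary n) = Data.unary (S.coins n)) (l : Data) :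
    mapD (sampleCoins fc) (Data.unary n) l =
      (iid ((S.toss n).map Data.bits) l.len).map Data.list :=
  mapD_const (fun _ => coinString_toss h) l

theorem iid_bits (k : ℕ) : iid ((S.toss n).map Data.bits) k =
    (PMF.uniformOfFintype (Fin k → S.Coin n)).map fun r => List.ofFn fun j => Data.bits (r j) := by
  rw [iid_map, HEScheme.toss, iid_uniform, PMF.map_comp]
  congr 1
  funext r
  simp [Function.comp_def]

/-- The server's view when the client sends encryptions of `y`. -/
def serverViewD (S : HEScheme R) (n : ℕ) (I : Inference (R n)) (y : Fin I.k → R n) : PMF Data :=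
  (S.toss n).bind fun rK => (PMF.uniformOfFintype (Fin I.k → S.Coin n)).bind fun rE =>
    (iid ((S.toss n).map Data.bits) I.net.tosses).map fun log =>
      Data.list [serverInput S n I, Data.list log, Data.list [S.pk n rK,
        Data.list (List.ofFn fun j => S.encrypt n (S.pk n rK) (y j) (rE j))]]

/-- The client's view when the server sends fresh encryptions of the result. -/
def clientViewD (S : HEScheme R) (n : ℕ) (I : Inference (R n)) : PMF Data :=
  (S.toss n).bind fun rK => (PMF.uniformOfFintype (Fin I.k → S.Coin n)).bind fun rE =>
    (indep (encD S n (S.pk n rK)) (List.ofFn (I.net.eval I.x))).map fun c =>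
      Data.list [clientInput S n I,
        Data.list [Data.bits rK, Data.list (List.ofFn fun j => Data.bits (rE j))], Data.list c]

/-- Everything needed is in the server's input: the number of zeros to encrypt is the common input
`1ᵏ`, and the number of logged coin strings is read off the code of the network. -/
theorem serverSim_eq (hc : fc (Data.unary n) = Data.unary (S.coins n))
    (hz : fz (Data.unary n) = S.code n 0) (I : Inference (R n)) :
    serverSim S fc fz (serverInput S n I) = serverViewD S n I 0 := by
  have e : ∀ pk, indep (encD S n pk) (List.replicate I.k (0 : R n)) =
      (PMF.uniformOfFintype (Fin I.k → S.Coin n)).map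
        fun r => List.ofFn fun j => S.encrypt n pk 0 (r j) := by
    intro pk
    have : indep (encD S n pk) (List.replicate I.k (0 : R n)) = iid (encD S n pk 0) I.k := by
      rw [iid, ← List.map_replicate (f := fun _ : Unit => (0 : R n)), indep_map_list]
    rw [this, encD, iid_map, HEScheme.toss, iid_uniform, PMF.map_comp]
    congr 1
    funext r
    simp [Function.comp_def]
  have z : Data.mapWith (fun x => fz x.hd) (Data.unary n) (Data.unary I.k) =
      Data.list ((List.replicate I.k (0 : R n)).map (S.code n)) := by
    simp [Data.unary, Data.mapWith_list] at hz ⊢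
    simp [hz]
  simp only [serverSim, serverInput, Data.list, Data.hd_cons, Data.tl_cons] at *
  rw [z, coinString_toss hc]
  simp only [mapD_sampleEnc hc, mapD_sampleCoins hc, len_netTosses, e, PMF.bind_map, PMF.map_comp,
    Function.comp_def, serverViewD, serverInput, Data.list, HEScheme.pk, Pi.zero_apply]

theorem clientSim_eq (hc : fc (Data.unary n) = Data.unary (S.coins n)) (I : Inference (R n)) :
    clientSim S fc (Data.list [clientInput S n I, (protocol S).result n I]) =
      clientViewD S n I := by
  have y : (protocol S).result n I =
      Data.list ((List.ofFn (I.net.eval I.x)).map (S.code n)) := by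
    rw [List.map_ofFn]
    rfl
  have k : (Data.unary I.k).len = I.k := by simp [Data.unary, Data.len_list]
  rw [y]
  simp only [clientSim, clientInput, Data.list, Data.hd_cons, Data.tl_cons]
  rw [coinString_toss hc]
  simp only [mapD_sampleEnc hc, mapD_sampleCoins hc, k, iid_bits, PMF.bind_map, PMF.map_comp,
    Function.comp_def, clientViewD, clientInput, Data.list, HEScheme.pk]

end Simulators

/-! ### Asymptotics -/

theorem Negligible.of_abs_le {f g : ℕ → ℝ} (hg : Negligible g) (k : ℕ)
    (h : ∀ n : ℕ, |f n| ≤ ((n ^ k + k : ℕ) : ℝ) * |g n|) : Negligible f := by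
  have h₁ : Negligible fun n => ((n : ℝ) ^ k) * g n := hg.param_pow_mul k
  have h₂ : Negligible fun n => (k : ℝ) * g n := hg.const_mul (k : ℝ)
  refine Asymptotics.SuperpolynomialDecay.trans_abs_le (h₁.add h₂) fun n => (h n).trans ?_
  simp only [Pi.add_apply]
  rw [← add_mul, abs_mul, abs_of_nonneg (by positivity : (0 : ℝ) ≤ (n : ℝ) ^ k + k)]
  push_cast
  exact le_rfl

theorem PolySize.cons {a b : ℕ → Data} (ha : PolySize a) (hb : PolySize b) :
    PolySize fun n => .cons (a n) (b n) := by
  obtain ⟨k, hk⟩ := ha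
  obtain ⟨l, hl⟩ := hb
  obtain ⟨e, he⟩ := exists_eval_le_pow (1 + (Polynomial.X ^ k + Polynomial.C k) +
    (Polynomial.X ^ l + Polynomial.C l))
  refine ⟨e, fun n => le_trans ?_ (he n)⟩
  simp only [Data.size, Polynomial.eval_add, Polynomial.eval_pow, Polynomial.eval_X,
    Polynomial.eval_C, Polynomial.eval_one]
  have := hk n
  have := hl n
  omega

theorem acceptProb_eq (D : Data → Data) (n : ℕ) (a : Data) (X : PMF Data) :
    acceptProb D n a X =
      (X.toOuterMeasure {v | D (Data.list [Data.unary n, a, v]) = Data.bit true}).toReal := by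
  rw [acceptProb, ← PMF.toOuterMeasure_apply_singleton, PMF.toOuterMeasure_map_apply]
  rfl

theorem Close.abs_acceptProb_sub_le {δ : ENNReal} {X Y : PMF Data} (h : Close δ X Y) (hδ : δ ≠ ⊤)
    (D : Data → Data) (n : ℕ) (a : Data) :
    |acceptProb D n a X - acceptProb D n a Y| ≤ δ.toReal := by
  simpa only [acceptProb_eq] using h.abs_sub_le hδ _

theorem acceptProb_bind_le {α : Type} {W : PMF α} {V V' : α → PMF Data} {c : ℝ} {D : Data → Data}
    {n : ℕ} {a : Data} (hc : 0 ≤ c)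
    (h : ∀ w ∈ W.support, acceptProb D n a (V w) ≤ acceptProb D n a (V' w) + c) :
    acceptProb D n a (W.bind V) ≤ acceptProb D n a (W.bind V') + c := by
  simp only [acceptProb_eq] at *
  set s := {v | D (Data.list [Data.unary n, a, v]) = Data.bit true}
  have h₁ : (W.bind V).toOuterMeasure s ≤ (W.bind V').toOuterMeasure s + ENNReal.ofReal c := by
    rw [PMF.toOuterMeasure_bind_apply, PMF.toOuterMeasure_bind_apply]
    calc ∑' w, W w * (V w).toOuterMeasure s
        ≤ ∑' w, (W w * (V' w).toOuterMeasure s + W w * ENNReal.ofReal c) := by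
          refine ENNReal.tsum_le_tsum fun w => ?_
          by_cases hw : w ∈ W.support
          · rw [← mul_add]
            gcongr
            rw [← ENNReal.toReal_le_toReal (toOuterMeasure_ne_top _ _)
              (ENNReal.add_ne_top.2 ⟨toOuterMeasure_ne_top _ _, ENNReal.ofReal_ne_top⟩),
              ENNReal.toReal_add (toOuterMeasure_ne_top _ _) ENNReal.ofReal_ne_top,
              ENNReal.toReal_ofReal hc]
            exact h w hw
          · rw [PMF.mem_support_iff, not_not] at hw
            simp [hw]
      _ = ∑' w, W w * (V' w).toOuterMeasure s + ENNReal.ofReal c := by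
          rw [ENNReal.tsum_add, ENNReal.tsum_mul_right, W.tsum_coe, one_mul]
  rw [← ENNReal.toReal_ofReal hc,
    ← ENNReal.toReal_add (toOuterMeasure_ne_top _ _) ENNReal.ofReal_ne_top]
  exact ENNReal.toReal_mono
    (ENNReal.add_ne_top.2 ⟨toOuterMeasure_ne_top _ _, ENNReal.ofReal_ne_top⟩) h₁

/-- Averaging: a bound for each fixed value of the common coins `w` survives mixing over them. The
hybrid argument uses this to fix all coins but those of the challenge. -/
theorem abs_acceptProb_bind_sub_le {α : Type} {W : PMF α} {V V' : α → PMF Data} {c : ℝ}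
    {D : Data → Data} {n : ℕ} {a : Data}
    (h : ∀ w ∈ W.support, |acceptProb D n a (V w) - acceptProb D n a (V' w)| ≤ c) :
    |acceptProb D n a (W.bind V) - acceptProb D n a (W.bind V')| ≤ c := by
  obtain ⟨w, hw⟩ := W.support_nonempty
  have hc := (abs_nonneg _).trans (h w hw)
  have h₁ := acceptProb_bind_le hc fun w hw =>
    (by linarith [(abs_le.1 (h w hw)).2] : acceptProb D n a (V w) ≤ acceptProb D n a (V' w) + c)
  have h₂ := acceptProb_bind_le hc fun w hw =>
    (by linarith [(abs_le.1 (h w hw)).1] : acceptProb D n a (V' w) ≤ acceptProb D n a (V w) + c)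
  rw [abs_le]
  constructor <;> linarith

theorem compIndist_of_close {X Y : ℕ → PMF Data} {ε : ℕ → ℝ} (hε : Negligible ε) {T : ℕ → ℕ}
    {k : ℕ} (hT : ∀ n, T n ≤ n ^ k + k)
    (h : ∀ n, Close (T n * ENNReal.ofReal (ε n)) (X n) (Y n)) : CompIndist X Y := by
  intro D _ a _
  refine hε.of_abs_le k fun n => ?_
  rw [abs_abs]
  refine ((h n).abs_acceptProb_sub_le (ENNReal.mul_ne_top (by simp) (by simp)) D n (a n)).trans ?_
  rw [ENNReal.toReal_mul, ENNReal.toReal_natCast, ENNReal.toReal_ofReal']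
  gcongr
  · exact_mod_cast hT n
  · exact max_le (le_abs_self _) (abs_nonneg _)

/-! ### Executions of the protocol -/

section Protocol

variable {R : ℕ → Type} [∀ n, CommRing (R n)] {S : HEScheme R} {n : ℕ}

theorem size_unary (n : ℕ) : (Data.unary n).size = 2 * n + 1 := by
  induction n with
  | zero => rfl
  | succ n ih =>
    have : Data.unary (n + 1) = .cons .nil (Data.unary n) := by
      simp [Data.unary, List.replicate_succ, Data.list]
    rw [this]
    simp only [Data.size, ih]
    omega

theorem execution_eq (I : Inference (R n)) : execution S n I =
    (S.toss n).bind fun rK => (PMF.uniformOfFintype (Fin I.k → S.Coin n)).bind fun rE =>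
      ((serverF S n (S.pk n rK) I.net
        (List.ofFn fun j => S.encrypt n (S.pk n rK) (I.x j) (rE j))).run []).map fun p =>
      { clientView := Data.list [clientInput S n I,
          Data.list [Data.bits rK, Data.list (List.ofFn fun j => Data.bits (rE j))],
          Data.list p.1]
        serverView := Data.list [serverInput S n I, Data.list p.2, Data.list [S.pk n rK,
          Data.list (List.ofFn fun j => S.encrypt n (S.pk n rK) (I.x j) (rE j))]]
        clientOutput := Data.list (p.1.map (S.decrypt n (S.sk n rK))) } := rfl

/-- An equality, with no error term: for any key and ciphertexts, the log of the server is a list of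
`I.net.tosses` independent coin strings, and the computed ciphertexts are not part of its view. -/
theorem serverView_eq (I : Inference (R n)) :
    (execution S n I).map Execution.serverView = serverViewD S n I I.x := by
  simp only [execution_eq, serverViewD, PMF.map_bind, PMF.map_comp]
  congr 1
  funext rK
  congr 1
  funext rE
  have h := (tosses_serverF (S := S) (pk := S.pk n rK) I.net
    (c := List.ofFn fun j => S.encrypt n (S.pk n rK) (I.x j) (rE j)) (by simp) []).1
  simp only [List.nil_append] at h
  rw [show (fun x : List Data => x) = id from rfl, PMF.map_id] at h
  rw [← h, PMF.map_comp]
  rfl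

/-- Any function of the client's coins and the received ciphertexts is distributed as if the server
sent fresh encryptions of the result. -/
theorem close_serverF {α : Type} {ε : ENNReal} (h : ∀ rK, OpsClose S n (S.pk n rK) ε)
    (I : Inference (R n)) (f : S.Coin n → (Fin I.k → S.Coin n) → List Data → α) :
    Close (I.net.tosses * ε)
      ((S.toss n).bind fun rK => (PMF.uniformOfFintype (Fin I.k → S.Coin n)).bind fun rE =>
        ((serverF S n (S.pk n rK) I.net
          (List.ofFn fun j => S.encrypt n (S.pk n rK) (I.x j) (rE j))).run []).map
          fun p => f rK rE p.1)
      ((S.toss n).bind fun rK => (PMF.uniformOfFintype (Fin I.k → S.Coin n)).bind fun rE =>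
        (indep (encD S n (S.pk n rK)) (List.ofFn (I.net.eval I.x))).map (f rK rE)) := by
  refine Close.bind_left _ fun rK => Close.bind_left _ fun rE => ?_
  have hc : Encrypts S n (S.pk n rK) (List.ofFn I.x)
      (List.ofFn fun j => S.encrypt n (S.pk n rK) (I.x j) (rE j)) := by
    rw [Encrypts, List.forall₂_iff_get]
    refine ⟨by simp, fun i h₁ h₂ => ?_⟩
    simp only [List.get_eq_getElem, List.getElem_ofFn, encD, PMF.mem_support_map_iff]
    exact ⟨_, by simp [HEScheme.toss], rfl⟩
  have := ((h rK).serverF I.net hc []).map (f rK rE)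
  rwa [PMF.map_comp] at this

theorem close_clientView {ε : ENNReal} (h : ∀ rK, OpsClose S n (S.pk n rK) ε)
    (I : Inference (R n)) :
    Close (I.net.tosses * ε) ((execution S n I).map Execution.clientView) (clientViewD S n I) := by
  have := close_serverF h I fun rK rE c => Data.list [clientInput S n I,
    Data.list [Data.bits rK, Data.list (List.ofFn fun j => Data.bits (rE j))], Data.list c]
  simp only [execution_eq, PMF.map_bind, PMF.map_comp]
  exact this

/-- With fresh encryptions of the result in place of the server's answer, decryption never fails and
the output is a point mass. Thus the statistical error bounds the failure probability. -/
theorem close_clientOutput {ε : ENNReal} (h : ∀ rK, OpsClose S n (S.pk n rK) ε)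
    (I : Inference (R n)) :
    Close (I.net.tosses * ε) ((execution S n I).map Execution.clientOutput)
      (PMF.pure ((protocol S).result n I)) := by
  have := close_serverF h I fun rK _ c => Data.list (c.map (S.decrypt n (S.sk n rK)))
  have dec : ∀ rK, (indep (encD S n (S.pk n rK)) (List.ofFn (I.net.eval I.x))).map
      (fun c => Data.list (c.map (S.decrypt n (S.sk n rK)))) =
        PMF.pure ((protocol S).result n I) := by
    intro rK
    rw [← PMF.bind_pure_comp,
      bind_congr_support (g := fun _ => PMF.pure ((protocol S).result n I)), PMF.bind_const]
    intro c hc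
    have hm : c.map (S.decrypt n (S.sk n rK)) = (List.ofFn (I.net.eval I.x)).map (S.code n) := by
      have h₁ := forall₂_of_mem_support_indep hc
      generalize List.ofFn (I.net.eval I.x) = y at h₁
      clear hc
      induction h₁ with
      | nil => rfl
      | cons h₁ _ ih =>
        rw [encD, PMF.mem_support_map_iff] at h₁
        obtain ⟨r, -, rfl⟩ := h₁
        rw [List.map_cons, List.map_cons, ih]
        congr 1
        exact S.dec_enc n rK r _
    simp only [Function.comp, hm, List.map_ofFn]
    rfl
  simp only [dec, PMF.bind_const] at this
  simp only [execution_eq, PMF.map_bind, PMF.map_comp]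
  exact this

/-! ### The hybrid argument -/

/-- Input `((1ⁿ, (pk, c)), i)`, output `c` if `i` is `nil`, otherwise the encryption described by
the pair `i` of a message and a coin string. -/
def fillCipher (S : HEScheme R) (z : Data) : Data :=
  Data.select z.tl (S.enc (Data.list [z.hd.hd, z.hd.tl.hd, z.tl.hd, z.tl.tl])) z.hd.tl.tl.hd

/-- The distinguisher that places its challenge into a server's view described by the advice. -/
def embed (S : HEScheme R) (D : Data → Data) (x : Data) : Data :=
  D (Data.list [x.hd, x.tl.hd.hd, Data.list [x.tl.hd.tl.hd, x.tl.hd.tl.tl.hd,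
    Data.list [x.tl.tl.hd.hd,
      Data.mapWith (fillCipher S) (.cons x.hd x.tl.tl.hd) x.tl.hd.tl.tl.tl.hd]]])

theorem polyTime_embed {D : Data → Data} (hD : PolyTime D) : PolyTime (embed S D) := by
  have hf : PolyTime (fillCipher S) := PolyTime.id.tl.select
    (S.enc_polyTime.comp (.list_cons PolyTime.id.hd.hd (.list_cons PolyTime.id.hd.tl.hd
      (.list_cons PolyTime.id.tl.hd (.list_cons PolyTime.id.tl.tl .list_nil)))))
    PolyTime.id.hd.tl.tl.hd
  exact hD.comp (.list_cons PolyTime.id.hd (.list_cons PolyTime.id.tl.hd.hd (.list_cons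
    (.list_cons PolyTime.id.tl.hd.tl.hd (.list_cons PolyTime.id.tl.hd.tl.tl.hd (.list_cons
      (.list_cons PolyTime.id.tl.tl.hd.hd (.list_cons
        (hf.mapWith (PolyTime.id.hd.cons PolyTime.id.tl.tl.hd) PolyTime.id.tl.hd.tl.tl.tl.hd)
        .list_nil)) .list_nil))) .list_nil)))

/-- The advice of `embed`: the server's view except for the key and the ciphertext number `i`. -/
def advice (S : HEScheme R) (n : ℕ) (I : Inference (R n)) (a : Data) (y : Fin I.k → R n)
    (i : Fin I.k) (w : (Fin I.k → S.Coin n) × List Data) : Data :=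
  Data.list [a, serverInput S n I, Data.list w.2, Data.list (List.ofFn fun j =>
    if j = i then Data.nil else .cons (S.code n (y j)) (Data.bits (w.1 j)))]

/-- The advice holds the other messages with their coins rather than ciphertexts, because the key
comes only with the challenge. The blank entry is where the challenge ciphertext goes. -/
theorem embed_advice (D : Data → Data) (I : Inference (R n)) (a : Data) (y : Fin I.k → R n)
    (i : Fin I.k) (w : (Fin I.k → S.Coin n) × List Data) (pk : Data) (r : S.Coin n) :
    embed S D (Data.list [Data.unary n, advice S n I a y i w,
        Data.list [pk, S.encrypt n pk (y i) r]]) =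
      D (Data.list [Data.unary n, a, Data.list [serverInput S n I, Data.list w.2,
        Data.list [pk, Data.list (List.ofFn fun j =>
          S.encrypt n pk (y j) (Function.update w.1 i r j))]]]) := by
  have : Data.mapWith (fillCipher S)
      (.cons (Data.unary n) (Data.list [pk, S.encrypt n pk (y i) r]))
      (Data.list (List.ofFn fun j =>
        if j = i then Data.nil else .cons (S.code n (y j)) (Data.bits (w.1 j)))) =
      Data.list (List.ofFn fun j => S.encrypt n pk (y j) (Function.update w.1 i r j)) := by
    rw [Data.mapWith_list, List.map_ofFn]
    congr 2
    funext j
    by_cases hj : j = i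
    · subst hj
      simp [fillCipher, Data.select, Data.list]
    · simp [fillCipher, Data.select, Data.list, hj, HEScheme.encrypt]
  rw [← this]
  rfl

/-- Exchanging coordinate `i` with the extra sample is an involution of the product, hence preserves
the uniform distribution. -/
theorem uniform_bind_update {ι α : Type} [Fintype ι] [DecidableEq ι] [Fintype α] [Nonempty α]
    (i : ι) : ((PMF.uniformOfFintype (ι → α)).bind fun f =>
      (PMF.uniformOfFintype α).map (Function.update f i)) = PMF.uniformOfFintype (ι → α) := by
  let e : (ι → α) × α ≃ (ι → α) × α :=
    Function.Involutive.toPerm (fun p => (Function.update p.1 i p.2, p.1 i)) (by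
      rintro ⟨f, r⟩
      simp)
  have h := congrArg (PMF.map Prod.fst) (uniformOfFintype_map_equiv e)
  rw [PMF.map_comp, uniformOfFintype_prod] at h
  simp only [PMF.map_bind, PMF.map_comp] at h
  have h' : ∀ f : ι → α, (Prod.fst : (ι → α) × α → ι → α) ∘ Prod.mk f = Function.const α f :=
    fun f => rfl
  simp only [h', PMF.map_const] at h
  rw [PMF.bind_pure] at h
  exact h

/-- The random choices of a server's view apart from the key. -/
def viewCoins (S : HEScheme R) (n : ℕ) (I : Inference (R n)) :
    PMF ((Fin I.k → S.Coin n) × List Data) :=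
  (PMF.uniformOfFintype (Fin I.k → S.Coin n)).bind fun rE =>
    (iid ((S.toss n).map Data.bits) I.net.tosses).map (Prod.mk rE)

/-- Redrawing the coins of ciphertext `i` leaves the view unchanged in distribution and makes that
ciphertext, with the key, a challenge independent of the coins `w` that enter the advice. -/
theorem serverViewD_eq (I : Inference (R n)) (y : Fin I.k → R n) (i : Fin I.k) :
    serverViewD S n I y = (viewCoins S n I).bind fun w => (S.toss n).bind fun rK =>
      (S.toss n).map fun r => Data.list [serverInput S n I, Data.list w.2,
        Data.list [S.pk n rK, Data.list (List.ofFn fun j =>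
          S.encrypt n (S.pk n rK) (y j) (Function.update w.1 i r j))]] := by
  rw [serverViewD, ← uniform_bind_update i, viewCoins]
  simp only [← PMF.bind_pure_comp, PMF.bind_bind, PMF.pure_bind, Function.comp_def]
  rw [PMF.bind_comm]
  congr 1
  funext f
  rw [PMF.bind_comm (iid _ _)]
  congr 1
  funext rK
  rw [PMF.bind_comm]
  rfl

theorem acceptProb_embed (D : Data → Data) (I : Inference (R n)) (a : Data) (y : Fin I.k → R n)
    (i : Fin I.k) (w : (Fin I.k → S.Coin n) × List Data) :
    acceptProb (embed S D) n (advice S n I a y i w) (S.challenge n (y i)) =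
      acceptProb D n a ((S.toss n).bind fun rK => (S.toss n).map fun r =>
        Data.list [serverInput S n I, Data.list w.2,
          Data.list [S.pk n rK, Data.list (List.ofFn fun j =>
            S.encrypt n (S.pk n rK) (y j) (Function.update w.1 i r j))]]) := by
  simp only [acceptProb, HEScheme.challenge, PMF.map_bind, PMF.map_comp, Function.comp_def,
    embed_advice]

/-- Otherwise every two neighbouring hybrids differ by at most `δ / (2 k)`, and the `k` steps from
`x` to 0 add up to at most `δ / 2`. The factor 2 makes this contradict `δ > 0`. -/
theorem exists_challenge (D : Data → Data) (I : Inference (R n)) (a : Data) (hk : 0 < I.k)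
    (x : Fin I.k → R n) :
    ∃ (y : Fin I.k → R n) (i : Fin I.k), ∃ w ∈ (viewCoins S n I).support,
      |acceptProb D n a (serverViewD S n I x) - acceptProb D n a (serverViewD S n I 0)| ≤
        2 * I.k * |acceptProb (embed S D) n (advice S n I a y i w) (S.challenge n (x i)) -
          acceptProb (embed S D) n (advice S n I a y i w) (S.challenge n 0)| := by
  by_contra! hcon
  set δ := |acceptProb D n a (serverViewD S n I x) - acceptProb D n a (serverViewD S n I 0)|
    with hδ
  have hk' : (0 : ℝ) < I.k := by exact_mod_cast hk
  have hpos : 0 < δ := by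
    obtain ⟨w, hw⟩ := (viewCoins S n I).support_nonempty
    exact lt_of_le_of_lt (by positivity) (hcon x ⟨0, hk⟩ w hw)
  -- Hybrid `t` has its first `t` coordinates replaced by 0.
  let y : ℕ → Fin I.k → R n := fun t j => if (j : ℕ) < t then 0 else x j
  have hstep : ∀ t < I.k, dist (acceptProb D n a (serverViewD S n I (y t)))
      (acceptProb D n a (serverViewD S n I (y (t + 1)))) ≤ δ / (2 * I.k) := by
    intro t ht
    let i : Fin I.k := ⟨t, ht⟩
    rw [serverViewD_eq I (y t) i, serverViewD_eq I (y (t + 1)) i, Real.dist_eq]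
    refine abs_acceptProb_bind_sub_le fun w hw => ?_
    rw [← acceptProb_embed, ← acceptProb_embed]
    -- The hybrids `t` and `t + 1` differ only in coordinate `t`, which is blank in the advice.
    have h₁ : advice S n I a (y (t + 1)) i w = advice S n I a (y t) i w := by
      simp only [advice]
      congr 7
      funext j
      by_cases hj : j = i
      · simp [hj]
      · have : (j : ℕ) ≠ t := fun h => hj (Fin.ext h)
        have : (j : ℕ) < t + 1 ↔ (j : ℕ) < t := by omega
        simp [hj, y, this]
    have h₂ : y t i = x i := by simp [y, i]
    have h₃ : y (t + 1) i = 0 := by simp [y, i]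
    rw [h₁, h₂, h₃]
    have := hcon (y t) i w hw
    rw [le_div_iff₀ (by positivity)]
    linarith
  have h₀ : y 0 = x := by funext j; simp [y]
  have h₁ : y I.k = 0 := by funext j; simp [y]
  have h := dist_le_range_sum_dist (fun t => acceptProb D n a (serverViewD S n I (y t))) I.k
  have h₂ := h.trans (Finset.sum_le_sum fun t ht => hstep t (Finset.mem_range.1 ht))
  rw [Finset.sum_const, Finset.card_range, nsmul_eq_mul, h₀, h₁, Real.dist_eq, ← hδ] at h₂
  have h₃ : (I.k : ℝ) * (δ / (2 * I.k)) = δ / 2 := by field_simp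
  linarith

/-! ### Polynomial size of the advice -/

theorem Data.size_list_le {l : List Data} {b : ℕ} (h : ∀ x ∈ l, x.size ≤ b) :
    (Data.list l).size ≤ 1 + l.length * (b + 1) := by
  induction l with
  | nil => simp [Data.list, Data.size]
  | cons a l ih =>
    have h₁ := ih fun x hx => h x (List.mem_cons_of_mem _ hx)
    have h₂ := h a List.mem_cons_self
    simp only [Data.list, Data.size, List.length_cons, add_mul]
    omega

theorem size_bits_le {l : ℕ} (r : Fin l → Bool) : (Data.bits r).size ≤ 1 + l * 4 := by
  have := Data.size_list_le (l := List.ofFn fun i => Data.bit (r i)) (b := 3) (by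
    intro x hx
    rw [List.mem_ofFn] at hx
    obtain ⟨i, rfl⟩ := hx
    cases r i <;> simp [Data.bit, Data.size])
  simpa [Data.bits] using this

theorem size_serverInput (I : Inference (R n)) :
    (serverInput S n I).size = 2 * n + 2 * I.k + 2 * I.m + (I.net.code (S.code n)).size + 8 := by
  simp only [serverInput, Data.list, Data.size, size_unary]
  omega

variable (S)

theorem exists_tosses_le : ∃ P : Polynomial ℕ, ∀ (n : ℕ) (I : Inference (R n)),
    I.net.tosses ≤ P.eval (serverInput S n I).size := by
  obtain ⟨P, hP⟩ := polyTime_netTosses.exists_size_le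
  refine ⟨P, fun n I => ?_⟩
  rw [← len_netTosses (S.code n)]
  refine (Data.len_le_size _).trans ((hP _).trans (eval_mono P ?_))
  rw [size_serverInput]
  omega

theorem exists_coins_le : ∃ P : Polynomial ℕ, ∀ (n : ℕ) (I : Inference (R n)),
    S.coins n ≤ P.eval (serverInput S n I).size := by
  obtain ⟨fc, hfc, h⟩ := S.coins_code
  obtain ⟨P, hP⟩ := hfc.exists_size_le
  refine ⟨P, fun n I => ?_⟩
  have h₁ := hP (Data.unary n)
  rw [h, size_unary, size_unary] at h₁
  have h₂ := eval_mono P (show 2 * n + 1 ≤ (serverInput S n I).size by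
    rw [size_serverInput]
    omega)
  omega

/-- Fixed coins are legitimate advice because in the support of `viewCoins` both the number and the
lengths of the coin strings are polynomial in the server's input. -/
theorem exists_advice_size_le : ∃ P : Polynomial ℕ, ∀ (n : ℕ) (I : Inference (R n)) (a : Data)
    (y : Fin I.k → R n) (i : Fin I.k), ∀ w ∈ (viewCoins S n I).support,
      (advice S n I a y i w).size ≤ P.eval (Data.cons (serverInput S n I) a).size := by
  obtain ⟨PT, hT⟩ := exists_tosses_le S
  obtain ⟨PC, hC⟩ := exists_coins_le S
  obtain ⟨e, he⟩ := S.code_size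
  let X : Polynomial ℕ := Polynomial.X
  let B : Polynomial ℕ := 1 + PC * 4
  refine ⟨5 + X + (1 + PT * (B + 1)) + (1 + X * ((1 + (X ^ e + Polynomial.C e) + B) + 1)),
    fun n I a y i w hw => ?_⟩
  rw [viewCoins, PMF.mem_support_bind_iff] at hw
  obtain ⟨rE, -, hw⟩ := hw
  rw [iid_bits, PMF.map_comp, PMF.mem_support_map_iff] at hw
  obtain ⟨rL, -, rfl⟩ := hw
  have hs : (serverInput S n I).size ≤ (Data.cons (serverInput S n I) a).size := by
    simp only [Data.size]
    omega
  have hsa : (serverInput S n I).size + a.size ≤ (Data.cons (serverInput S n I) a).size := by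
    simp only [Data.size]
    omega
  set s := (Data.cons (serverInput S n I) a).size
  have hT' := (hT n I).trans (eval_mono PT hs)
  have hC' := (hC n I).trans (eval_mono PC hs)
  have hn : n ≤ s ∧ I.k ≤ s := by
    rw [size_serverInput] at hs
    omega
  have hbits : ∀ r : S.Coin n, (Data.bits r).size ≤ B.eval s := by
    intro r
    refine (size_bits_le r).trans ?_
    simp only [B, Polynomial.eval_add, Polynomial.eval_mul, Polynomial.eval_one,
      Polynomial.eval_ofNat]
    omega
  have hlog : (Data.list (List.ofFn fun j => Data.bits (rL j))).size ≤
      1 + PT.eval s * (B.eval s + 1) := by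
    refine (Data.size_list_le (b := B.eval s) ?_).trans ?_
    · intro x hx
      rw [List.mem_ofFn] at hx
      obtain ⟨j, rfl⟩ := hx
      exact hbits _
    · rw [List.length_ofFn]
      gcongr
  have hitems : (Data.list (List.ofFn fun j => if j = i then Data.nil else
      .cons (S.code n (y j)) (Data.bits (rE j)))).size ≤
      1 + s * ((1 + (s ^ e + e) + B.eval s) + 1) := by
    refine (Data.size_list_le (b := 1 + (s ^ e + e) + B.eval s) ?_).trans ?_
    · intro x hx
      rw [List.mem_ofFn] at hx
      obtain ⟨j, rfl⟩ := hx
      have h₁ := hbits (rE j)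
      have h₂ := he n (y j)
      have h₃ := Nat.pow_le_pow_left hn.1 e
      split_ifs
      · simp only [Data.size]
        omega
      · simp only [Data.size]
        omega
    · rw [List.length_ofFn]
      gcongr
      exact hn.2
  simp only [X, Polynomial.eval_add, Polynomial.eval_mul, Polynomial.eval_one,
    Polynomial.eval_ofNat, Polynomial.eval_X, Polynomial.eval_pow, Polynomial.eval_C]
  simp only [advice, Data.list, Data.size, Function.comp] at hlog hitems ⊢
  omega

variable {S}

theorem compIndist_serverViewD (hsem : S.SemanticallySecure) (I : ∀ n, Inference (R n))
    (hI : PolySize fun n => serverInput S n (I n)) :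
    CompIndist (fun n => serverViewD S n (I n) (I n).x) (fun n => serverViewD S n (I n) 0) := by
  intro D hD a ha
  obtain ⟨P, hP⟩ := exists_advice_size_le S
  have key : ∀ n, ∃ (m₀ m₁ : R n) (b : Data),
      -- The added 1 pays for the advice `nil` of size 1 in the case of an empty input.
      b.size ≤ (P + 1).eval (Data.cons (serverInput S n (I n)) (a n)).size ∧
      |acceptProb D n (a n) (serverViewD S n (I n) (I n).x) -
        acceptProb D n (a n) (serverViewD S n (I n) 0)| ≤
      2 * (I n).k * |acceptProb (embed S D) n b (S.challenge n m₀) -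
        acceptProb (embed S D) n b (S.challenge n m₁)| := by
    intro n
    rcases Nat.eq_zero_or_pos (I n).k with hk | hk
    · refine ⟨0, 0, .nil, by simp [Data.size], ?_⟩
      have : (I n).x = 0 := by
        funext j
        exact absurd j.2 (by omega)
      simp [this]
    · obtain ⟨y, i, w, hw, h⟩ := exists_challenge (S := S) D (I n) (a n) hk (I n).x
      refine ⟨_, _, _, (hP n (I n) (a n) y i w hw).trans ?_, h⟩
      simp
  -- The hybrid index and the coins may vary with n without any uniformity: they enter only through
  -- the advice and the two message sequences, while the algorithm `embed S D` stays the same.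
  choose m₀ m₁ b hb h using key
  have hsize := polySize_of_eval (hI.cons ha) _ hb
  obtain ⟨l, hl⟩ := hI
  refine (hsem m₀ m₁ (embed S D) (polyTime_embed hD) b hsize).of_abs_le l fun n => ?_
  rw [abs_abs, abs_abs]
  refine (h n).trans ?_
  gcongr
  have h₁ := hl n
  rw [size_serverInput] at h₁
  -- The server's input contains `1ᵏ`, whose code has `2 k + 1` nodes; this absorbs the hybrid loss
  -- `2 k`.
  have : 2 * (I n).k ≤ n ^ l + l := by omega
  exact_mod_cast this

end Protocol

/-! ### Assembly of the three security properties -/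

theorem secureSemiHonest {R : ℕ → Type} [∀ n, CommRing (R n)] (S : HEScheme R)
    (hsem : S.SemanticallySecure) (hhom : S.StronglyHomomorphic) :
    (protocol S).SecureSemiHonest := by
  obtain ⟨ε, hε, hops⟩ := hhom
  obtain ⟨fc, hfc, hc⟩ := S.coins_code
  obtain ⟨fz, hfz, hz⟩ := S.zero_code
  have hops' : ∀ n rK, OpsClose S n (S.pk n rK) (ENNReal.ofReal (ε n)) :=
    fun n rK => opsClose_of_statClose (hops n rK)
  have hT : ∀ I : ∀ n, Inference (R n), (PolySize fun n => serverInput S n (I n)) →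
      ∃ k, ∀ n, (I n).net.tosses ≤ n ^ k + k := by
    intro I ⟨k, hk⟩
    obtain ⟨P, hP⟩ := exists_tosses_le S
    obtain ⟨l, hl⟩ := exists_eval_le_pow (P.comp (Polynomial.X ^ k + Polynomial.C k))
    refine ⟨l, fun n => (hP n (I n)).trans (le_trans ?_ (hl n))⟩
    rw [Polynomial.eval_comp]
    exact eval_mono P (by simpa using hk n)
  refine ⟨fun I hI => ?_, ⟨clientSim S fc, ppt_clientSim hfc, fun I hI => ?_⟩,
    ⟨serverSim S fc fz, ppt_serverSim hfc hfz, fun I hI => ?_⟩⟩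
  · obtain ⟨k, hk⟩ := hT I hI.2
    refine hε.of_abs_le k fun n => ?_
    -- The event of a wrong output has probability 0 under the ideal point mass, so the distance
    -- itself bounds its real probability.
    have h := (close_clientOutput (hops' n) (I n)).abs_sub_le
      (ENNReal.mul_ne_top (by simp) (by simp)) {c | c ≠ (protocol S).result n (I n)}
    rw [PMF.toOuterMeasure_map_apply, PMF.toOuterMeasure_pure_apply, if_neg (by simp),
      ENNReal.toReal_zero, sub_zero, ENNReal.toReal_mul, ENNReal.toReal_natCast,
      ENNReal.toReal_ofReal'] at h
    refine h.trans ?_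
    gcongr
    · exact_mod_cast hk n
    · exact max_le (le_abs_self _) (abs_nonneg _)
  · obtain ⟨k, hk⟩ := hT I hI.2
    refine compIndist_of_close hε hk fun n => ?_
    have : clientSim S fc _ = clientViewD S n (I n) := clientSim_eq (hc n) (I n)
    exact this ▸ close_clientView (hops' n) (I n)
  · have h := compIndist_serverViewD hsem I hI.2
    have h₁ : ∀ n, serverSim S fc fz (serverInput S n (I n)) = serverViewD S n (I n) 0 :=
      fun n => serverSim_eq (hc n) (hz n) (I n)
    have h₂ : ∀ n, (execution S n (I n)).map Execution.serverView =
        serverViewD S n (I n) (I n).x := fun n => serverView_eq (I n)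
    simp only [← h₁, ← h₂] at h
    exact h

end Proud

end

theorem mainTheorem1 {R : ℕ → Type} [∀ n, CommRing (R n)] (S : Proud.HEScheme R)
    (hsem : S.SemanticallySecure) (hhom : S.StronglyHomomorphic) :
    (Proud.protocol S).SecureSemiHonest := by
  exact Proud.secureSemiHonest S hsem hhom
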